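/- Let $M$ be a smooth manifold (finite-dimensional, Hausdorff, second countable, without boundary), let $E\to M$ be a smooth oriented real vector bundle of rank $2m$, and let $\nabla$ be a smooth connection on $E$. For a smooth local frame $s=(s_1,\dots,s_{2m})$ of $E$ on an open set $U$ let $\omega=(\omega^i_j)$ be the connection matrix, $\nabla s_j=\sum_i\omega^i_j\otimes s_i$, and let $\Omega_s=d\omega+\omega\wedge\omega$, i.e. $\Omega^i_j=d\omega^i_j+\sum_k\omega^i_k\wedge\omega^k_j$, be the curvature matrix of $\nabla$ in this frame. Assume that $\nabla$ is quasi-metric: every point of $M$ has an open neighbourhood with a smooth local frame $s$ in which $\Omega_s^T=-\Omega_s$. For a skew-symmetric $2m\times 2m$ matrix $\Omega$ of two-forms put $$\mathrm{Pf}(\Omega)=\frac1{2^m m!}\sum_{\sigma\in S_{2m}}\mathrm{sgn}(\sigma)\,\Omega_{\sigma(1)\sigma(2)}\wedge\cdots\wedge\Omega_{\sigma(2m-1)\sigma(2m)} .$$ Then: 1. If $s$ on $U$ and $s'$ on $U'$ are positively oriented smooth local frames in which the curvature matrices $\Omega_s$, $\Omega_{s'}$ are skew-symmetric, then $\mathrm{Pf}(\Omega_s)=\mathrm{Pf}(\Omega_{s'})$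 on $U\cap U'$. 2. There is exactly one $2m$-form $\mathrm e(\nabla)$ on $M$ with $\mathrm e(\nabla)|_U=\mathrm{Pf}(\Omega_s)$ for every positively oriented smooth local frame $s$ on an open set $U$ in which $\Omega_s$ is skew-symmetric. 3. The form $\mathrm e(\nabla)$ is smooth and closed. 4. Consequently the Euler class $[\mathrm e(\nabla)]$ is a well-defined element of the de Rham cohomology group $H^{2m}(M,\mathbb R)$ (closed smooth $2m$-forms modulo exact ones). -/

import Mathlib

open Bundle Module
open scoped Manifold ContDiff Topology

noncomputable section

namespace QuasiMetric

/-! ### Multilinear algebra: wedge products and the Pfaffian -/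

section Algebra

variable {T : Type*} [AddCommGroup T] [Module ℝ T] [TopologicalSpace T]

/-- The wedge product of two covectors, `(α ∧ β)(v, w) = α v * β w - α w * β v`. -/
def wedgeOne (α β : T →L[ℝ] ℝ) : T [⋀^Fin 2]→L[ℝ] ℝ :=
  ContinuousMultilinearMap.alternatization
    ((ContinuousMultilinearMap.mkPiAlgebra ℝ (Fin 2) ℝ).compContinuousLinearMap ![α, β])

theorem wedgeOne_apply (α β : T →L[ℝ] ℝ) (v : Fin 2 → T) :
    wedgeOne α β v = α (v 0) * β (v 1) - α (v 1) * β (v 0) := by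
  have h : (Finset.univ : Finset (Equiv.Perm (Fin 2))) = {1, Equiv.swap 0 1} := by decide
  rw [wedgeOne, ContinuousMultilinearMap.alternatization_apply_apply, h,
    Finset.sum_pair (by decide)]
  simp [Fin.prod_univ_two, sub_eq_add_neg]

/-- The bijection `(i, b) ↦ 2 * i + b` that groups `0, …, 2m - 1` into `m` consecutive pairs. -/
def pairIndex (m : ℕ) : (Σ _ : Fin m, Fin 2) ≃ Fin (2 * m) :=
  (Equiv.sigmaEquivProd (Fin m) (Fin 2)).trans
    (finProdFinEquiv.trans (finCongr (Nat.mul_comm m 2)))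

theorem pairIndex_val {m : ℕ} (i : Fin m) (b : Fin 2) :
    (pairIndex m ⟨i, b⟩ : ℕ) = 2 * i + b := by
  simp [pairIndex, Nat.add_comm]

/-- The tensor product of `m` two-forms,
`(v₀, …, v₂ₘ₋₁) ↦ ∏ i, θ i (v₂ᵢ, v₂ᵢ₊₁)`. -/
def tensorTwo {m : ℕ} (θ : Fin m → T [⋀^Fin 2]→L[ℝ] ℝ) :
    ContinuousMultilinearMap ℝ (fun _ : Fin (2 * m) => T) ℝ where
  toMultilinearMap :=
    ((MultilinearMap.mkPiAlgebra ℝ (Fin m) ℝ).compMultilinearMap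
      (fun i => (θ i).toContinuousMultilinearMap.toMultilinearMap)).domDomCongr (pairIndex m)
  cont := by
    have h : ∀ i, Continuous fun v : Fin (2 * m) → T =>
        θ i (fun b => v (pairIndex m ⟨i, b⟩)) := fun i =>
      (θ i).cont.comp (continuous_pi fun b => continuous_apply _)
    exact continuous_finsetProd Finset.univ fun i _ => h i

theorem tensorTwo_apply {m : ℕ} (θ : Fin m → T [⋀^Fin 2]→L[ℝ] ℝ) (v : Fin (2 * m) → T) :
    tensorTwo θ v = ∏ i, θ i (fun b => v (pairIndex m ⟨i, b⟩)) := by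
  rfl

/-- The wedge product `θ₀ ∧ ⋯ ∧ θₘ₋₁` of `m` two-forms: its value on `v` is
`2⁻ᵐ ∑ τ, sign τ * ∏ i, θ i (v (τ (2i)), v (τ (2i+1)))`. -/
def wedgeTwo {m : ℕ} (θ : Fin m → T [⋀^Fin 2]→L[ℝ] ℝ) : T [⋀^Fin (2 * m)]→L[ℝ] ℝ :=
  ((2 : ℝ) ^ m)⁻¹ • ContinuousMultilinearMap.alternatization (tensorTwo θ)

/-- The Pfaffian of a `2m × 2m` matrix of two-forms,
`Pf Ω = 1 / (2ᵐ m!) ∑ σ, sign σ • Ω_{σ(0)σ(1)} ∧ ⋯ ∧ Ω_{σ(2m-2)σ(2m-1)}`. -/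
def pfaffian {m : ℕ} (Ω : Matrix (Fin (2 * m)) (Fin (2 * m)) (T [⋀^Fin 2]→L[ℝ] ℝ)) :
    T [⋀^Fin (2 * m)]→L[ℝ] ℝ :=
  ((2 : ℝ) ^ m * (m.factorial : ℝ))⁻¹ • ∑ σ : Equiv.Perm (Fin (2 * m)),
    ((Equiv.Perm.sign σ : ℤ) : ℝ) •
      wedgeTwo fun i => Ω (σ (pairIndex m ⟨i, 0⟩)) (σ (pairIndex m ⟨i, 1⟩))

end Algebra

/-! ### Differential forms on a manifold and de Rham cohomology -/

section Forms

variable {E : Type*} [NormedAddCommGroup E] [NormedSpace ℝ E]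
  {M : Type*} [TopologicalSpace M] [ChartedSpace E M]

variable (E M) in
/-- Fields of alternating `k`-forms on `M`, without any regularity. -/
def FormField (k : ℕ) : Type _ :=
  ∀ x : M, TangentSpace 𝓘(ℝ, E) x [⋀^Fin k]→L[ℝ] ℝ

instance (k : ℕ) : AddCommGroup (FormField E M k) :=
  inferInstanceAs (AddCommGroup (∀ x : M, TangentSpace 𝓘(ℝ, E) x [⋀^Fin k]→L[ℝ] ℝ))

instance (k : ℕ) : Module ℝ (FormField E M k) :=
  inferInstanceAs (Module ℝ (∀ x : M, TangentSpace 𝓘(ℝ, E) x [⋀^Fin k]→L[ℝ] ℝ))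

@[simp]
theorem FormField.add_apply {k : ℕ} (α β : FormField E M k) (x : M) :
    (α + β) x = α x + β x := rfl

@[simp]
theorem FormField.smul_apply {k : ℕ} (c : ℝ) (α : FormField E M k) (x : M) :
    (c • α) x = c • α x := rfl

@[simp]
theorem FormField.zero_apply {k : ℕ} (x : M) : (0 : FormField E M k) x = 0 := rfl

/-- The coordinate expression of a form in the chart `φ`, that is, its pullback under `φ⁻¹`
(meaningful on `φ.target`). -/
def inChart {k : ℕ} (φ : OpenPartialHomeomorph M E) (α : FormField E M k) (y : E) :
    E [⋀^Fin k]→L[ℝ] ℝ :=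
  (α (φ.symm y)).compContinuousLinearMap
    ((mfderiv 𝓘(ℝ, E) 𝓘(ℝ, E) φ.symm y).comp
      ((NormedSpace.fromTangentSpace (𝕜 := ℝ) y).symm : E →L[ℝ] TangentSpace 𝓘(ℝ, E) y))

/-- A form is smooth if its coordinate expression in every chart of the atlas is. -/
def IsSmoothForm {k : ℕ} (α : FormField E M k) : Prop :=
  ∀ φ ∈ atlas E M, ContDiffOn ℝ ∞ (inChart φ α) φ.target

/-- The exterior derivative at `x` is computed in the preferred chart at `x`
and pulled back to the tangent space at `x`. -/
def extD {k : ℕ} (α : FormField E M k) : FormField E M (k + 1) := fun x =>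
  (extDeriv (inChart (chartAt E x) α) (chartAt E x x)).compContinuousLinearMap
    ((NormedSpace.fromTangentSpace (𝕜 := ℝ) (chartAt E x x) :
        TangentSpace 𝓘(ℝ, E) (chartAt E x x) →L[ℝ] E).comp
      (mfderiv 𝓘(ℝ, E) 𝓘(ℝ, E) (chartAt E x) x))

theorem inChart_add {k : ℕ} (φ : OpenPartialHomeomorph M E) (α η : FormField E M k) :
    inChart φ (α + η) = inChart φ α + inChart φ η := rfl

theorem inChart_smul {k : ℕ} (φ : OpenPartialHomeomorph M E) (c : ℝ) (α : FormField E M k) :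
    inChart φ (c • α) = c • inChart φ α := rfl

theorem inChart_zero {k : ℕ} (φ : OpenPartialHomeomorph M E) :
    inChart φ (0 : FormField E M k) = 0 := rfl

variable (E M) in
/-- The space `Ω^k(M)` of smooth `k`-forms. -/
def smoothForms (k : ℕ) : Submodule ℝ (FormField E M k) where
  carrier := {α | IsSmoothForm α}
  add_mem' hα hη φ hφ := by
    rw [inChart_add]
    exact (hα φ hφ).add (hη φ hφ)
  zero_mem' φ hφ := by
    rw [inChart_zero]
    exact contDiffOn_const
  smul_mem' c α hα φ hφ := by
    rw [inChart_smul]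
    exact contDiffOn_const.smul (hα φ hφ)

theorem IsSmoothForm.differentiableAt {k : ℕ} {α : FormField E M k} (hα : IsSmoothForm α) (x : M) :
    DifferentiableAt ℝ (inChart (chartAt E x) α) (chartAt E x x) :=
  ((hα _ (chart_mem_atlas E x)).differentiableOn (by simp)).differentiableAt
    ((chartAt E x).open_target.mem_nhds (mem_chart_target E x))

theorem extD_add {k : ℕ} {α η : FormField E M k} (hα : IsSmoothForm α) (hη : IsSmoothForm η) :
    extD (α + η) = extD α + extD η := by
  funext x
  simp only [extD, inChart_add, FormField.add_apply,
    extDeriv_add (hα.differentiableAt x) (hη.differentiableAt x)]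
  rfl

theorem extD_smul {k : ℕ} (c : ℝ) (α : FormField E M k) : extD (c • α) = c • extD α := by
  funext x
  simp only [extD, inChart_smul, FormField.smul_apply, extDeriv_smul]
  rfl

variable (E M) in
/-- The exterior derivative as a linear map on smooth forms. -/
def extDLin (k : ℕ) : smoothForms E M k →ₗ[ℝ] FormField E M (k + 1) where
  toFun α := extD α.1
  map_add' α η := extD_add α.2 η.2
  map_smul' c α := extD_smul c α.1

variable (E M) in
/-- Closed smooth `k`-forms. -/
def closedForms (k : ℕ) : Submodule ℝ (FormField E M k) :=
  (LinearMap.ker (extDLin E M k)).map (smoothForms E M k).subtype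

variable (E M) in
/-- Exact `k`-forms: differentials of smooth `(k-1)`-forms; in degree zero only `0`. -/
def exactForms : ∀ k : ℕ, Submodule ℝ (FormField E M k)
  | 0 => ⊥
  | k + 1 => LinearMap.range (extDLin E M k)

theorem mem_closedForms {k : ℕ} {α : FormField E M k} :
    α ∈ closedForms E M k ↔ IsSmoothForm α ∧ extD α = 0 := by
  constructor
  · rintro ⟨η, hη, rfl⟩
    exact ⟨η.2, hη⟩
  · rintro ⟨h, h'⟩
    exact ⟨⟨α, h⟩, h', rfl⟩

variable (E M) in
/-- De Rham cohomology `H^k(M, ℝ)`: closed smooth `k`-forms modulo exact ones. -/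
abbrev DeRham (k : ℕ) : Type _ :=
  closedForms E M k ⧸ (exactForms E M k).submoduleOf (closedForms E M k)

/-- The cohomology class of a closed form. -/
def deRhamClass {k : ℕ} (α : closedForms E M k) : DeRham E M k :=
  Submodule.Quotient.mk α

end Forms

/-! ### Connections, curvature matrices, orientations -/

section Bundles

variable {E : Type*} [NormedAddCommGroup E] [NormedSpace ℝ E] [FiniteDimensional ℝ E]
  {M : Type*} [TopologicalSpace M] [ChartedSpace E M]
  {F : Type*} [NormedAddCommGroup F] [NormedSpace ℝ F]
  {V : M → Type*} [TopologicalSpace (TotalSpace F V)]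
  [∀ x, AddCommGroup (V x)] [∀ x, Module ℝ (V x)] [∀ x, TopologicalSpace (V x)]
  [FiberBundle F V]
  [∀ x, IsTopologicalAddGroup (V x)] [∀ x, ContinuousSMul ℝ (V x)]
  {r : ℕ} {u : Set M} {s : Fin r → (x : M) → V x}

/-- The connection one-forms `ω^i_j` of `∇` in the local frame `s`, given by
`∇ s_j = ∑ i, ω^i_j ⊗ s_i` (they are zero outside the domain of the frame). -/
def connectionForm (cov : CovariantDerivative 𝓘(ℝ, E) F V)
    (hs : IsLocalFrameOn 𝓘(ℝ, E) F ∞ s u) (i j : Fin r) (x : M) :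
    TangentSpace 𝓘(ℝ, E) x →L[ℝ] ℝ :=
  haveI : T2Space (TangentSpace 𝓘(ℝ, E) x) := inferInstanceAs (T2Space E)
  haveI : FiniteDimensional ℝ (TangentSpace 𝓘(ℝ, E) x) := inferInstanceAs (FiniteDimensional ℝ E)
  LinearMap.toContinuousLinearMap (hs.coeff i x ∘ₗ (cov (s j) x).toLinearMap)

/-- The curvature matrix `Ω = dω + ω ∧ ω` of `∇` in the local frame `s`, that is,
`Ω^i_j = d ω^i_j + ∑ k, ω^i_k ∧ ω^k_j`. -/
def curvatureMatrix (cov : CovariantDerivative 𝓘(ℝ, E) F V)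
    (hs : IsLocalFrameOn 𝓘(ℝ, E) F ∞ s u) (x : M) :
    Matrix (Fin r) (Fin r) (TangentSpace 𝓘(ℝ, E) x [⋀^Fin 2]→L[ℝ] ℝ) :=
  Matrix.of fun i j =>
    extD (fun y => ContinuousAlternatingMap.ofSubsingleton ℝ (TangentSpace 𝓘(ℝ, E) y) ℝ (0 : Fin 1)
      (connectionForm cov hs i j y)) x
    + ∑ k, wedgeOne (connectionForm cov hs i k x) (connectionForm cov hs k j x)

/-- The curvature matrix of `∇` in the local frame `s` is skew-symmetric on `u`. -/
def HasSkewCurvature (cov : CovariantDerivative 𝓘(ℝ, E) F V)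
    (hs : IsLocalFrameOn 𝓘(ℝ, E) F ∞ s u) : Prop :=
  ∀ x ∈ u, (curvatureMatrix cov hs x).transpose = -curvatureMatrix cov hs x

/-- A connection on a bundle of rank `r` is quasi-metric if near every point there is a smooth
local frame in which its curvature matrix is skew-symmetric. -/
def IsQuasiMetric (r : ℕ) (cov : CovariantDerivative 𝓘(ℝ, E) F V) : Prop :=
  ∀ p : M, ∃ u : Set M, IsOpen u ∧ p ∈ u ∧ ∃ (s : Fin r → (x : M) → V x)
    (hs : IsLocalFrameOn 𝓘(ℝ, E) F ∞ s u), HasSkewCurvature cov hs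

variable (E F V) in
/-- An orientation of a bundle of rank `r`: an orientation of every fibre such that near each
point there is a smooth local frame that is positively oriented in every fibre. -/
structure BundleOrientation (r : ℕ) where
  /-- The orientation of the fibre over `x`. -/
  orient : ∀ x : M, Orientation ℝ (V x) (Fin r)
  exists_frame : ∀ p : M, ∃ u : Set M, IsOpen u ∧ p ∈ u ∧ ∃ (s : Fin r → (x : M) → V x)
    (hs : IsLocalFrameOn 𝓘(ℝ, E) F ∞ s u), ∀ (x : M) (hx : x ∈ u),
      (hs.toBasisAt hx).orientation = orient x

/-- The local frame `s` is positively oriented on `u`. -/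
def IsPositiveFrame (o : BundleOrientation E F V r)
    (hs : IsLocalFrameOn 𝓘(ℝ, E) F ∞ s u) : Prop :=
  ∀ (x : M) (hx : x ∈ u), (hs.toBasisAt hx).orientation = o.orient x

/-- `η` is an Euler form of the connection: on the domain of each positively oriented local frame
in which the curvature matrix `Ω` is skew-symmetric, it equals `Pf Ω`. -/
def IsEulerForm {m : ℕ} (o : BundleOrientation E F V (2 * m))
    (cov : CovariantDerivative 𝓘(ℝ, E) F V) (η : FormField E M (2 * m)) : Prop :=
  ∀ (u : Set M) (s : Fin (2 * m) → (x : M) → V x) (hs : IsLocalFrameOn 𝓘(ℝ, E) F ∞ s u),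
    IsOpen u → IsPositiveFrame o hs → HasSkewCurvature cov hs →
      ∀ x ∈ u, η x = pfaffian (curvatureMatrix cov hs x)

end Bundles

end QuasiMetric

end

/-!
The curvature matrix of a connection changes by conjugation, `Ω' = g⁻¹ Ω g`, under a change of frame
`g` (`sum_coeff_mul_curvatureMatrix`). For a quasi-metric connection the frames with skew-symmetric
`Ω` need not be related by orthogonal matrices, and their connection matrices need not be
skew-symmetric, so both the invariance and the closedness of the Pfaffian need an argument beyond
the metric case.

*Invariance.* If `Ω` and `g⁻¹ Ω g` are both skew-symmetric, then `Ω` commutes with `g gᵀ`, hence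
with its positive square root `p`, so that `g⁻¹ Ω g = k⁻¹ Ω k` for the orthogonal matrix
`k = p⁻¹ g`.
Since `Pf (k X kᵀ) = det k · Pf X`, the Pfaffians agree as soon as `det g > 0`
(`polarPfaffian_eq_of_conj`). Positively oriented frames with skew-symmetric curvature exist near
every point (`exists_positive_skew_frame`), so the local Pfaffians glue.

*Closedness.* By the Bianchi identity `dΩ = Ω ∧ ω - ω ∧ Ω` (`bianchi`) and the product rule,
`d Pf(Ω)` is the antisymmetrization of `∑ i, Pf(Ω, …, [Ω, ω], …, Ω)`. Only the skew-symmetric part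
of each argument matters to the Pfaffian, and for skew-symmetric `Ω` the symmetric part of `ω`
contributes a symmetric commutator. Thus `ω` may be replaced by its skew-symmetric part, and the sum
vanishes by the infinitesimal form of the invariance of the Pfaffian
(`sum_polarPfaffian_update_commutator`, `extDeriv_eq_zero_of_eventually_eq_polarPfaffian`).

Everything is evaluated on fixed tangent vectors, which turns the Pfaffian of a matrix of two-forms
into an antisymmetrized sum of polarised Pfaffians of real matrices (`pfaffian_apply`) and avoids
the algebra of wedge products.
-/

noncomputable section

namespace QuasiMetric

/-! ### The polarised Pfaffian of real matrices -/

section PolarPfaffian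

variable {m : ℕ}

/-- The full polarisation of the Pfaffian, up to the factor `2ᵐ m!`: a multilinear function of `m`
real `2m × 2m` matrices, not assumed skew-symmetric. -/
def polarPfaffian (X : Fin m → Matrix (Fin (2 * m)) (Fin (2 * m)) ℝ) : ℝ :=
  ∑ σ : Equiv.Perm (Fin (2 * m)), ((Equiv.Perm.sign σ : ℤ) : ℝ) *
    ∏ i, X i (σ (pairIndex m ⟨i, 0⟩)) (σ (pairIndex m ⟨i, 1⟩))

theorem polarPfaffian_update (X : Fin m → Matrix (Fin (2 * m)) (Fin (2 * m)) ℝ) (i : Fin m)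
    (Y : Matrix (Fin (2 * m)) (Fin (2 * m)) ℝ) :
    polarPfaffian (Function.update X i Y) =
      ∑ σ : Equiv.Perm (Fin (2 * m)), ((Equiv.Perm.sign σ : ℤ) : ℝ) *
        (Y (σ (pairIndex m ⟨i, 0⟩)) (σ (pairIndex m ⟨i, 1⟩)) *
          ∏ j ∈ Finset.univ.erase i, X j (σ (pairIndex m ⟨j, 0⟩)) (σ (pairIndex m ⟨j, 1⟩))) := by
  refine Finset.sum_congr rfl fun σ _ => ?_
  rw [← Finset.mul_prod_erase _ _ (Finset.mem_univ i), Function.update_self]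
  congr 2
  refine Finset.prod_congr rfl fun j hj => ?_
  rw [Function.update_of_ne (Finset.ne_of_mem_erase hj)]

theorem polarPfaffian_update_add (X : Fin m → Matrix (Fin (2 * m)) (Fin (2 * m)) ℝ) (i : Fin m)
    (Y Z : Matrix (Fin (2 * m)) (Fin (2 * m)) ℝ) :
    polarPfaffian (Function.update X i (Y + Z)) =
      polarPfaffian (Function.update X i Y) + polarPfaffian (Function.update X i Z) := by
  simp only [polarPfaffian_update, ← Finset.sum_add_distrib, Matrix.add_apply]
  exact Finset.sum_congr rfl fun σ _ => by ring

theorem polarPfaffian_update_neg (X : Fin m → Matrix (Fin (2 * m)) (Fin (2 * m)) ℝ) (i : Fin m)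
    (Y : Matrix (Fin (2 * m)) (Fin (2 * m)) ℝ) :
    polarPfaffian (Function.update X i (-Y)) = -polarPfaffian (Function.update X i Y) := by
  simp only [polarPfaffian_update, ← Finset.sum_neg_distrib, Matrix.neg_apply]
  exact Finset.sum_congr rfl fun σ _ => by ring

/-- Each slot of the polarised Pfaffian sees only the skew-symmetric part of its argument. -/
theorem polarPfaffian_update_transpose (X : Fin m → Matrix (Fin (2 * m)) (Fin (2 * m)) ℝ)
    (i : Fin m) (Y : Matrix (Fin (2 * m)) (Fin (2 * m)) ℝ) :
    polarPfaffian (Function.update X i Y.transpose) =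
      -polarPfaffian (Function.update X i Y) := by
  simp only [polarPfaffian_update, ← Finset.sum_neg_distrib]
  have hne : pairIndex m ⟨i, 0⟩ ≠ pairIndex m ⟨i, 1⟩ := by simp
  refine Fintype.sum_equiv (Equiv.mulRight (Equiv.swap (pairIndex m ⟨i, 0⟩) (pairIndex m ⟨i, 1⟩)))
    _ _ fun σ => ?_
  have hprod : ∀ j ∈ Finset.univ.erase i, ∀ b : Fin 2,
      Equiv.swap (pairIndex m ⟨i, 0⟩) (pairIndex m ⟨i, 1⟩) (pairIndex m ⟨j, b⟩) =
        pairIndex m ⟨j, b⟩ := by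
    intro j hj b
    have hj' := Finset.ne_of_mem_erase hj
    apply Equiv.swap_apply_of_ne_of_ne <;> simp [hj']
  rw [Finset.prod_congr rfl fun j hj => by
    rw [← hprod j hj 0, ← hprod j hj 1]]
  simp [Equiv.Perm.sign_swap hne, Matrix.transpose_apply]

/-- The bilinear form with matrix `Y`. -/
def bilinOfMatrix {n : ℕ} (Y : Matrix (Fin n) (Fin n) ℝ) :
    MultilinearMap ℝ (fun _ : Fin 2 => Fin n → ℝ) ℝ :=
  ∑ a, ∑ b, Y a b • (MultilinearMap.mkPiAlgebra ℝ (Fin 2) ℝ).compLinearMap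
    ![LinearMap.proj a, LinearMap.proj b]

theorem bilinOfMatrix_apply {n : ℕ} (Y : Matrix (Fin n) (Fin n) ℝ) (w : Fin 2 → Fin n → ℝ) :
    bilinOfMatrix Y w = ∑ a, ∑ b, Y a b * (w 0 a * w 1 b) := by
  simp [bilinOfMatrix, Fin.prod_univ_two]

/-- The polarised Pfaffian is the value, at the rows of the identity, of a top-degree alternating
map; its value at the rows of `k` is the left-hand side. -/
theorem polarPfaffian_mul_mul_transpose (X : Fin m → Matrix (Fin (2 * m)) (Fin (2 * m)) ℝ)
    (k : Matrix (Fin (2 * m)) (Fin (2 * m)) ℝ) :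
    polarPfaffian (fun i => k * X i * k.transpose) = k.det * polarPfaffian X := by
  let T : MultilinearMap ℝ (fun _ : Fin (2 * m) => Fin (2 * m) → ℝ) ℝ :=
    ((MultilinearMap.mkPiAlgebra ℝ (Fin m) ℝ).compMultilinearMap
      (fun i => bilinOfMatrix (X i))).domDomCongr (pairIndex m)
  have hT : ∀ w, T w = ∏ i, bilinOfMatrix (X i) (fun b => w (pairIndex m ⟨i, b⟩)) := fun w => rfl
  let f := MultilinearMap.alternatization T
  have hf : ∀ l : Fin (2 * m) → Fin (2 * m) → ℝ,
      f l = polarPfaffian (fun i => Matrix.of l * X i * (Matrix.of l).transpose) := by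
    intro l
    refine (MultilinearMap.alternatization_apply T l).trans (Finset.sum_congr rfl fun σ _ => ?_)
    rw [MultilinearMap.domDomCongr_apply, hT, Units.smul_def, zsmul_eq_mul]
    congr 1
    refine Finset.prod_congr rfl fun i _ => ?_
    rw [bilinOfMatrix_apply]
    simp only [Matrix.mul_apply, Matrix.transpose_apply, Matrix.of_apply, Finset.sum_mul]
    rw [Finset.sum_comm]
    exact Finset.sum_congr rfl fun b _ => Finset.sum_congr rfl fun a _ => by ring
  have h1 : Matrix.of ⇑(Pi.basisFun ℝ (Fin (2 * m))) = 1 := by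
    ext a b
    simp [Matrix.one_apply, Pi.single_apply, eq_comm]
  have h2 : f (Pi.basisFun ℝ (Fin (2 * m))) = polarPfaffian X := by
    rw [hf, h1]
    simp only [Matrix.one_mul, Matrix.transpose_one, Matrix.mul_one]
  have h := f.eq_smul_basis_det (Pi.basisFun ℝ (Fin (2 * m)))
  rw [Pi.basisFun_det, h2] at h
  calc polarPfaffian (fun i => k * X i * k.transpose) = f (fun a b => k a b) := (hf k).symm
    _ = polarPfaffian X * k.det := congrArg (fun g => g (fun a b => k a b)) h
    _ = k.det * polarPfaffian X := mul_comm _ _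

/-- The product rule for the polarised Pfaffian. -/
theorem hasFDerivAt_polarPfaffian {G : Type*} [NormedAddCommGroup G] [NormedSpace ℝ G]
    {X : Fin m → G → Matrix (Fin (2 * m)) (Fin (2 * m)) ℝ}
    {X' : Fin m → Fin (2 * m) → Fin (2 * m) → G →L[ℝ] ℝ} {y : G}
    (hX : ∀ i a b, HasFDerivAt (fun z => X i z a b) (X' i a b) y) :
    ∃ L : G →L[ℝ] ℝ, HasFDerivAt (fun z => polarPfaffian fun i => X i z) L y ∧
      ∀ w, L w = ∑ i, polarPfaffian
        (Function.update (fun j => X j y) i (Matrix.of fun a b => X' i a b w)) := by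
  refine ⟨_, HasFDerivAt.fun_sum fun σ _ =>
    (HasFDerivAt.finsetProd (u := Finset.univ) fun i _ => hX i _ _).const_mul _, fun w => ?_⟩
  simp only [polarPfaffian_update]
  rw [Finset.sum_comm]
  simp only [FunLike.coe_sum, Finset.sum_apply, FunLike.coe_smul, Pi.smul_apply,
    smul_eq_mul, Finset.mul_sum, Matrix.of_apply]
  exact Finset.sum_congr rfl fun σ _ => Finset.sum_congr rfl fun i _ => by ring

/-- The infinitesimal form of `polarPfaffian_mul_mul_transpose`: its derivative at `k = 1` in the
direction `A`. -/
theorem sum_polarPfaffian_update_mul_add (X : Fin m → Matrix (Fin (2 * m)) (Fin (2 * m)) ℝ)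
    (A : Matrix (Fin (2 * m)) (Fin (2 * m)) ℝ) :
    ∑ i, polarPfaffian (Function.update X i (A * X i + X i * A.transpose)) =
      A.trace * polarPfaffian X := by
  have hl : ∀ i a b, HasFDerivAt
      (fun t : ℝ => ((1 + t • A) * X i * (1 + t • A).transpose) a b)
      (ContinuousLinearMap.toSpanSingleton ℝ ((A * X i + X i * A.transpose) a b)) 0 := by
    intro i a b
    have h : ∀ t : ℝ, ((1 + t • A) * X i * (1 + t • A).transpose) a b =
        X i a b + t * (A * X i + X i * A.transpose) a b
          + t ^ 2 * (A * X i * A.transpose) a b := by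
      intro t
      have : (1 + t • A) * X i * (1 + t • A).transpose =
          X i + t • (A * X i + X i * A.transpose) + t ^ 2 • (A * X i * A.transpose) := by
        simp only [Matrix.transpose_add, Matrix.transpose_one, Matrix.transpose_smul, add_mul,
          mul_add, Matrix.one_mul, Matrix.mul_one, smul_add, Matrix.smul_mul, Matrix.mul_smul,
          smul_smul, pow_two]
        abel
      rw [this]
      simp only [Matrix.add_apply, Matrix.smul_apply, smul_eq_mul]
    simp only [h]
    rw [← hasDerivAt_iff_hasFDerivAt]
    have := (((hasDerivAt_id (0 : ℝ)).mul_const ((A * X i + X i * A.transpose) a b)).const_add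
      (X i a b)).fun_add (((hasDerivAt_id (0 : ℝ)).fun_pow 2).mul_const
        ((A * X i * A.transpose) a b))
    simpa using this
  obtain ⟨L, hL, hL'⟩ := hasFDerivAt_polarPfaffian hl
  have h1 := hL.hasDerivAt
  simp only [polarPfaffian_mul_mul_transpose] at h1
  have h2 : HasDerivAt (fun t : ℝ => (1 + t • A).det * polarPfaffian X)
      (A.trace * polarPfaffian X) 0 := by
    have := ((((hasDerivAt_id (0 : ℝ)).const_mul A.trace).const_add 1).fun_add
      (((1 + (Polynomial.X : Polynomial ℝ) • A.map Polynomial.C).det.divX.divX.hasDerivAt 0).fun_mul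
        ((hasDerivAt_id (0 : ℝ)).fun_pow 2))).mul_const (polarPfaffian X)
    refine HasDerivAt.congr_of_eventuallyEq (this.congr_deriv (by simp))
      (Filter.Eventually.of_forall fun t => ?_)
    simp only [id_eq]
    rw [Matrix.det_one_add_smul]
  have h3 := h1.unique h2
  rw [hL'] at h3
  rw [← h3]
  refine Finset.sum_congr rfl fun i _ => ?_
  congr 1
  congr 1
  · simp
  · ext a b
    simp

/-- The polarised Pfaffian is invariant under the adjoint action of an arbitrary matrix `W`: the
symmetric part of `W` contributes commutators that are symmetric matrices. -/
theorem sum_polarPfaffian_update_commutator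
    (X : Fin m → Matrix (Fin (2 * m)) (Fin (2 * m)) ℝ)
    (hX : ∀ i, (X i).transpose = -X i) (W : Matrix (Fin (2 * m)) (Fin (2 * m)) ℝ) :
    ∑ i, polarPfaffian (Function.update X i (X i * W - W * X i)) = 0 := by
  have h : ∀ i, polarPfaffian (Function.update X i (X i * W - W * X i)) =
      2⁻¹ * polarPfaffian (Function.update X i
        ((W.transpose - W) * X i + X i * (W.transpose - W).transpose)) := by
    intro i
    have h1 := polarPfaffian_update_transpose X i (X i * W - W * X i)
    have h2 : (W.transpose - W) * X i + X i * (W.transpose - W).transpose =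
        (X i * W - W * X i) + -(X i * W - W * X i).transpose := by
      simp only [Matrix.transpose_sub, Matrix.transpose_mul, hX, Matrix.transpose_transpose]
      noncomm_ring
    rw [h2, polarPfaffian_update_add, polarPfaffian_update_neg, h1]
    ring
  simp only [h, ← Finset.mul_sum, sum_polarPfaffian_update_mul_add]
  simp

/-- Conjugate families of skew-symmetric matrices have the same polarised Pfaffian, if the
conjugating matrix has positive determinant; it need not be orthogonal. -/
theorem polarPfaffian_eq_of_conj {X X' : Fin m → Matrix (Fin (2 * m)) (Fin (2 * m)) ℝ}
    (hX : ∀ i, (X i).transpose = -X i) (hX' : ∀ i, (X' i).transpose = -X' i)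
    {g : Matrix (Fin (2 * m)) (Fin (2 * m)) ℝ} (hg : 0 < g.det)
    (h : ∀ i, g * X' i = X i * g) : polarPfaffian X' = polarPfaffian X := by
  -- `g * gᵀ` commutes with each `X i`, hence so does its square root `p`. This gives
  -- `g * X' i * gᵀ = X i * (g * gᵀ) = p * X i * pᵀ`, and `det p = det g`.
  open scoped MatrixOrder in
  have hpos : (g * g.transpose).PosSemidef := by
    simpa using Matrix.posSemidef_self_mul_conjTranspose g
  let p := CFC.sqrt (g * g.transpose)
  have hpp : p * p = g * g.transpose := CFC.sqrt_mul_sqrt_self _ hpos.nonneg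
  have hp : p.PosSemidef := Matrix.nonneg_iff_posSemidef.mp (CFC.sqrt_nonneg (g * g.transpose))
  have hpt : p.transpose = p := by simpa [Matrix.IsHermitian] using hp.isHermitian
  have hcomm : ∀ i, Commute (g * g.transpose) (X i) := by
    intro i
    have h1 := congrArg Matrix.transpose (h i)
    simp only [Matrix.transpose_mul, hX, hX', Matrix.neg_mul, Matrix.mul_neg, neg_inj] at h1
    rw [Commute, SemiconjBy, Matrix.mul_assoc, ← h1, ← Matrix.mul_assoc, h, Matrix.mul_assoc]
  have hpX : ∀ i, p * X i = X i * p := by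
    intro i
    have : Commute (CFC.sqrt (g * g.transpose)) (X i) := by
      rw [CFC.sqrt_eq_cfc]
      exact Commute.cfc_nnreal (hcomm i) _
    exact this
  have hdet : p.det = g.det := by
    have h1 : p.det * p.det = g.det * g.det := by
      rw [← Matrix.det_mul, hpp, Matrix.det_mul, Matrix.det_transpose]
    have h2 : 0 ≤ p.det := hp.det_nonneg
    nlinarith
  have h1 : polarPfaffian (fun i => g * X' i * g.transpose) =
      polarPfaffian (fun i => p * X i * p.transpose) := by
    congr 1
    funext i
    rw [h, hpt, hpX, Matrix.mul_assoc, Matrix.mul_assoc, hpp]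
  rw [polarPfaffian_mul_mul_transpose, polarPfaffian_mul_mul_transpose, hdet] at h1
  exact mul_left_cancel₀ hg.ne' h1

end PolarPfaffian

/-! ### Connection matrices on a normed space: change of frame and the Bianchi identity -/

section LocalCurvature

variable {E : Type*} [NormedAddCommGroup E] [NormedSpace ℝ E] {r : ℕ}

/-- The value `ω(v)` at `y` of a matrix `ω = a` of one-forms. -/
def formMatrix (a : Fin r → Fin r → E → E →L[ℝ] ℝ) (y v : E) : Matrix (Fin r) (Fin r) ℝ :=
  Matrix.of fun i j => a i j y v

/-- The derivative at `y` in the direction `u` of the value at `v` of a matrix of one-forms. -/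
def formMatrixDeriv (a : Fin r → Fin r → E → E →L[ℝ] ℝ) (y u v : E) : Matrix (Fin r) (Fin r) ℝ :=
  Matrix.of fun i j => fderiv ℝ (a i j) y u v

/-- The curvature `(dω + ω ∧ ω)(v, w)` at `y` of a matrix `ω = a` of one-forms on a normed
space. -/
def localCurvature (a : Fin r → Fin r → E → E →L[ℝ] ℝ) (y v w : E) : Matrix (Fin r) (Fin r) ℝ :=
  formMatrixDeriv a y v w - formMatrixDeriv a y w v +
    (formMatrix a y v * formMatrix a y w - formMatrix a y w * formMatrix a y v)

theorem localCurvature_apply (a : Fin r → Fin r → E → E →L[ℝ] ℝ) (y v w : E) (i j : Fin r) :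
    localCurvature a y v w i j = fderiv ℝ (a i j) y v w - fderiv ℝ (a i j) y w v +
      (∑ k, a i k y v * a k j y w - ∑ k, a i k y w * a k j y v) := by
  simp [localCurvature, formMatrixDeriv, formMatrix, Matrix.mul_apply]

theorem contDiffAt_localCurvature {a : Fin r → Fin r → E → E →L[ℝ] ℝ} {y : E}
    (ha : ∀ i j, ContDiffAt ℝ ∞ (a i j) y) (v w : E) (i j : Fin r) :
    ContDiffAt ℝ ∞ (fun z => localCurvature a z v w i j) y := by
  simp only [localCurvature_apply]
  have h1 : ∀ i j, ∀ v : E, ContDiffAt ℝ ∞ (fun z => a i j z v) y := fun i j v =>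
    (ha i j).clm_apply contDiffAt_const
  have h2 : ∀ v w : E, ContDiffAt ℝ ∞ (fun z => fderiv ℝ (a i j) z v w) y := fun v w =>
    (((ha i j).fderiv_right (m := ∞) (by simp)).clm_apply contDiffAt_const).clm_apply
      contDiffAt_const
  exact ((h2 v w).sub (h2 w v)).add
    ((ContDiffAt.sum fun k _ => (h1 i k v).mul (h1 k j w)).sub
      (ContDiffAt.sum fun k _ => (h1 i k w).mul (h1 k j v)))

/-- The derivative at `y` in the direction `u` of the curvature evaluated at `(v, w)`. -/
def localCurvatureDeriv (a : Fin r → Fin r → E → E →L[ℝ] ℝ) (y u v w : E) :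
    Matrix (Fin r) (Fin r) ℝ :=
  Matrix.of fun i j => fderiv ℝ (fun z => localCurvature a z v w i j) y u

set_option synthInstance.maxHeartbeats 200000 in
theorem hasFDerivAt_fderiv_apply {f : E → E →L[ℝ] ℝ} {y : E} (hf : ContDiffAt ℝ ∞ f y) (v w : E) :
    HasFDerivAt (fun z => fderiv ℝ f z v w)
      ((fderiv ℝ (fderiv ℝ f) y).flip v |>.flip w) y := by
  have h : HasFDerivAt (fderiv ℝ f) (fderiv ℝ (fderiv ℝ f) y) y :=
    (((hf.fderiv_right (m := ∞) (by simp)).differentiableAt (by simp)).hasFDerivAt)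
  simpa using (h.clm_apply (hasFDerivAt_const v y)).clm_apply (hasFDerivAt_const w y)

theorem fderiv_fderiv_symm {G : Type*} [NormedAddCommGroup G] [NormedSpace ℝ G] {f : E → G} {y : E}
    (hf : ContDiffAt ℝ ∞ f y) (u v : E) :
    fderiv ℝ (fderiv ℝ f) y u v = fderiv ℝ (fderiv ℝ f) y v u :=
  hf.isSymmSndFDerivAt (by simpa using WithTop.coe_le_coe.2 (le_top : (2 : ℕ∞) ≤ ⊤)) u v

theorem localCurvatureDeriv_eq {a : Fin r → Fin r → E → E →L[ℝ] ℝ} {y : E}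
    (ha : ∀ i j, ContDiffAt ℝ ∞ (a i j) y) (u v w : E) :
    localCurvatureDeriv a y u v w =
      Matrix.of (fun i j => fderiv ℝ (fderiv ℝ (a i j)) y u v w) -
      Matrix.of (fun i j => fderiv ℝ (fderiv ℝ (a i j)) y u w v) +
      (formMatrixDeriv a y u v * formMatrix a y w + formMatrix a y v * formMatrixDeriv a y u w -
      (formMatrixDeriv a y u w * formMatrix a y v + formMatrix a y w * formMatrixDeriv a y u v)) := by
  ext i j
  simp only [localCurvatureDeriv, Matrix.of_apply, localCurvature_apply]
  have h1 : ∀ i j, ∀ v : E, HasFDerivAt (fun z => a i j z v)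
      ((ContinuousLinearMap.apply ℝ ℝ v).comp (fderiv ℝ (a i j) y)) y := fun i j v =>
    (ContinuousLinearMap.apply ℝ ℝ v).hasFDerivAt.comp y
      ((ha i j).differentiableAt (by simp)).hasFDerivAt
  have h2 : ∀ v w : E, HasFDerivAt (fun z => fderiv ℝ (a i j) z v w)
      ((fderiv ℝ (fderiv ℝ (a i j)) y).flip v |>.flip w) y := hasFDerivAt_fderiv_apply (ha i j)
  have h3 := ((h2 v w).fun_sub (h2 w v)).fun_add
    ((HasFDerivAt.fun_sum (u := Finset.univ) fun k _ => (h1 i k v).fun_mul (h1 k j w)).fun_sub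
      (HasFDerivAt.fun_sum (u := Finset.univ) fun k _ => (h1 i k w).fun_mul (h1 k j v)))
  rw [h3.fderiv]
  simp only [FunLike.coe_add, FunLike.coe_sub, FunLike.coe_sum, FunLike.coe_smul, Pi.add_apply,
    Pi.sub_apply, Finset.sum_apply, Pi.smul_apply, ContinuousLinearMap.comp_apply,
    ContinuousLinearMap.apply_apply, ContinuousLinearMap.flip_apply, smul_eq_mul,
    Matrix.add_apply, Matrix.sub_apply,
    Matrix.of_apply, Matrix.mul_apply, formMatrix, formMatrixDeriv, ← Finset.sum_add_distrib]
  congr 1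
  congr 1 <;> exact Finset.sum_congr rfl fun k _ => by ring

/-- The Bianchi identity `dΩ = Ω ∧ ω - ω ∧ Ω`. -/
theorem bianchi {a : Fin r → Fin r → E → E →L[ℝ] ℝ} {y : E}
    (ha : ∀ i j, ContDiffAt ℝ ∞ (a i j) y) (u v w : E) :
    localCurvatureDeriv a y u v w + localCurvatureDeriv a y v w u +
        localCurvatureDeriv a y w u v =
      (localCurvature a y v w * formMatrix a y u - formMatrix a y u * localCurvature a y v w) +
      (localCurvature a y w u * formMatrix a y v - formMatrix a y v * localCurvature a y w u) +
      (localCurvature a y u v * formMatrix a y w - formMatrix a y w * localCurvature a y u v) := by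
  have hs : ∀ u v w : E, Matrix.of (fun i j => fderiv ℝ (fderiv ℝ (a i j)) y u v w) =
      Matrix.of (fun i j => fderiv ℝ (fderiv ℝ (a i j)) y v u w) := by
    intro u v w
    ext i j
    simp only [Matrix.of_apply, fderiv_fderiv_symm (ha i j) u v]
  rw [localCurvatureDeriv_eq ha, localCurvatureDeriv_eq ha, localCurvatureDeriv_eq ha,
    hs v u w, hs w u v, hs w v u]
  simp only [localCurvature]
  noncomm_ring

/-- If two connection matrices are related by the gauge transformation `g ω' = ω g + dg`, their
curvatures are related by `g Ω' = Ω g`. -/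
theorem mul_localCurvature_of_gauge {a a' : Fin r → Fin r → E → E →L[ℝ] ℝ}
    {g : E → Matrix (Fin r) (Fin r) ℝ} {y : E}
    (ha : ∀ i j, DifferentiableAt ℝ (a i j) y) (ha' : ∀ i j, DifferentiableAt ℝ (a' i j) y)
    (hg : ∀ i j, ContDiffAt ℝ ∞ (fun z => g z i j) y)
    (h : ∀ᶠ z in 𝓝 y, ∀ v, g z * formMatrix a' z v =
      formMatrix a z v * g z + Matrix.of fun i j => fderiv ℝ (fun x => g x i j) z v) (v w : E) :
    g y * localCurvature a' y v w = localCurvature a y v w * g y := by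
  have h0 := h.self_of_nhds
  let G' : E → Matrix (Fin r) (Fin r) ℝ := fun u =>
    Matrix.of fun i j => fderiv ℝ (fun x => g x i j) y u
  let S : E → E → Matrix (Fin r) (Fin r) ℝ := fun u v =>
    Matrix.of fun i j => fderiv ℝ (fderiv ℝ (fun x => g x i j)) y u v
  have hS : ∀ u v, S u v = S v u := by
    intro u v
    ext i j
    simp only [S, Matrix.of_apply, fderiv_fderiv_symm (hg i j) u v]
  have h1 : ∀ u v, G' u * formMatrix a' y v + g y * formMatrixDeriv a' y u v =
      formMatrixDeriv a y u v * g y + formMatrix a y v * G' u + S u v := by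
    intro u v
    ext i j
    have hga : ∀ {b : Fin r → Fin r → E → E →L[ℝ] ℝ}, (∀ i j, DifferentiableAt ℝ (b i j) y) →
        ∀ i j, HasFDerivAt (fun z => b i j z v)
          ((ContinuousLinearMap.apply ℝ ℝ v).comp (fderiv ℝ (b i j) y)) y := fun hb i j =>
      (ContinuousLinearMap.apply ℝ ℝ v).hasFDerivAt.comp y (hb i j).hasFDerivAt
    have hgg : ∀ i j, HasFDerivAt (fun z => g z i j) (fderiv ℝ (fun x => g x i j) y) y :=
      fun i j => ((hg i j).differentiableAt (by simp)).hasFDerivAt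
    have hl := HasFDerivAt.fun_sum (u := Finset.univ) fun k _ =>
      (hgg i k).fun_mul (hga ha' k j)
    have hr := (HasFDerivAt.fun_sum (u := Finset.univ) fun k _ =>
      (hga ha i k).fun_mul (hgg k j)).fun_add
        ((ContinuousLinearMap.apply ℝ ℝ v).hasFDerivAt.comp y
          (((hg i j).fderiv_right (m := ∞) (by simp)).differentiableAt (by simp)).hasFDerivAt)
    have he := hl.congr_of_eventuallyEq (f₁ := fun z => (∑ k, a i k z v * g z k j) +
        ((ContinuousLinearMap.apply ℝ ℝ v) ∘ fderiv ℝ (fun x => g x i j)) z) (by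
      filter_upwards [h] with z hz
      have := congrFun (congrFun (hz v) i) j
      simp only [Matrix.mul_apply, Matrix.add_apply, formMatrix, Matrix.of_apply] at this
      simp [this])
    have hu := congrArg (fun L : E →L[ℝ] ℝ => L u) (he.unique hr)
    simp only [FunLike.coe_add, FunLike.coe_sum, FunLike.coe_smul, Pi.add_apply,
      Finset.sum_apply, Pi.smul_apply, ContinuousLinearMap.comp_apply,
      ContinuousLinearMap.apply_apply, smul_eq_mul, Finset.sum_add_distrib] at hu
    simp only [G', S, Matrix.add_apply, Matrix.of_apply, Matrix.mul_apply, formMatrix,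
      formMatrixDeriv]
    simp only [mul_comm (fderiv ℝ (fun x => g x _ _) y u),
      mul_comm (fderiv ℝ (a _ _) y u v)]
    linear_combination hu
  have h2 : ∀ u v, g y * formMatrix a' y u * formMatrix a' y v =
      formMatrix a y u * (formMatrix a y v * g y + G' v) + G' u * formMatrix a' y v := by
    intro u v
    rw [h0 u, add_mul, mul_assoc, h0 v]
  have h3 : ∀ u v, g y * formMatrixDeriv a' y u v = formMatrixDeriv a y u v * g y +
      formMatrix a y v * G' u + S u v - G' u * formMatrix a' y v :=
    fun u v => eq_sub_of_add_eq' (h1 u v)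
  simp only [localCurvature, mul_add, mul_sub, ← mul_assoc, h2, h3, hS w v]
  noncomm_ring

end LocalCurvature

/-! ### The Pfaffian of the curvature is closed -/

section Antisymmetrization

variable {T : Type*} {n : ℕ}

/-- The antisymmetrization of a function of `n` arguments, not divided by `n!`. -/
def antisym (f : (Fin n → T) → ℝ) (v : Fin n → T) : ℝ :=
  ∑ ρ : Equiv.Perm (Fin n), ((Equiv.Perm.sign ρ : ℤ) : ℝ) * f (v ∘ ρ)

theorem antisym_comp_perm (f : (Fin n → T) → ℝ) (κ : Equiv.Perm (Fin n)) (v : Fin n → T) :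
    antisym (fun u => f (u ∘ κ)) v = ((Equiv.Perm.sign κ : ℤ) : ℝ) * antisym f v := by
  simp only [antisym, Finset.mul_sum]
  refine Fintype.sum_equiv (Equiv.mulRight κ) _ _ fun ρ => ?_
  have h : (((Equiv.Perm.sign κ : ℤ) : ℝ) * ((Equiv.Perm.sign κ : ℤ) : ℝ)) = 1 := by
    exact_mod_cast Int.units_coe_mul_self _
  simp only [Equiv.coe_mulRight, Equiv.Perm.sign_mul, Units.val_mul, Int.cast_mul,
    Equiv.Perm.coe_mul, ← Function.comp_assoc]
  linear_combination -(((Equiv.Perm.sign ρ : ℤ) : ℝ) * f ((v ∘ ρ) ∘ κ)) * h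

theorem antisym_add (f g : (Fin n → T) → ℝ) (v : Fin n → T) :
    antisym (fun u => f u + g u) v = antisym f v + antisym g v := by
  simp only [antisym, mul_add, Finset.sum_add_distrib]

theorem antisym_sum {ι : Type*} (s : Finset ι) (f : ι → (Fin n → T) → ℝ) (v : Fin n → T) :
    antisym (fun u => ∑ i ∈ s, f i u) v = ∑ i ∈ s, antisym (f i) v := by
  simp only [antisym, Finset.mul_sum]
  exact Finset.sum_comm

theorem antisym_const_mul (c : ℝ) (f : (Fin n → T) → ℝ) (v : Fin n → T) :
    antisym (fun u => c * f u) v = c * antisym f v := by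
  simp only [antisym, Finset.mul_sum]
  exact Finset.sum_congr rfl fun ρ _ => by ring

/-- If `F` and `F'` have the same sum over the cyclic permutations of three arguments, they have
the same antisymmetrization. -/
theorem antisym_eq_of_cyclic_sum_eq {F F' : (Fin n → T) → ℝ} {i j k : Fin n} (hij : i ≠ j)
    (hjk : j ≠ k)
    (h : ∀ u : Fin n → T,
      let c : Equiv.Perm (Fin n) := Equiv.swap i j * Equiv.swap j k
      F u + F (u ∘ c) + F ((u ∘ c) ∘ c) = F' u + F' (u ∘ c) + F' ((u ∘ c) ∘ c)) (v : Fin n → T) :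
    antisym F v = antisym F' v := by
  let c : Equiv.Perm (Fin n) := Equiv.swap i j * Equiv.swap j k
  have hc : Equiv.Perm.sign c = 1 := by
    simp [c, Equiv.Perm.sign_swap hij, Equiv.Perm.sign_swap hjk]
  have h3 : ∀ f : (Fin n → T) → ℝ,
      antisym (fun u => f u + f (u ∘ c) + f ((u ∘ c) ∘ c)) v = 3 * antisym f v := by
    intro f
    rw [antisym_add, antisym_add, antisym_comp_perm f c,
      antisym_comp_perm (fun u => f (u ∘ c)) c, antisym_comp_perm f c, hc]
    simp
    ring
  have h4 := (h3 F).symm.trans ((congrArg (antisym · v) (funext h)).trans (h3 F'))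
  linarith

/-- An alternating map that is a sum of values of `F` over all ways to choose a first argument and
to permute the others vanishes if the antisymmetrization of `F` does. -/
theorem alternating_eq_zero_of_antisym [AddCommGroup T] [Module ℝ T]
    (f : T [⋀^Fin (n + 1)]→ₗ[ℝ] ℝ) {F : (Fin (n + 1) → T) → ℝ} (hF : ∀ v, antisym F v = 0)
    (h : ∀ u, f u = ∑ p : Fin (n + 1), (-1) ^ (p : ℕ) *
      antisym (fun u' => F (Fin.cons (u p) u')) (p.removeNth u)) : f = 0 := by
  ext v
  -- `κ p τ` sends `0` to `p` and then runs through the other indices in the order given by `τ`;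
  -- its sign is `(-1) ^ p * sign τ`.
  let κ : Fin (n + 1) → Equiv.Perm (Fin n) → Equiv.Perm (Fin (n + 1)) := fun p τ =>
    p.cycleRange.symm * Equiv.Perm.decomposeFin.symm (0, τ)
  have hκ : ∀ (u : Fin (n + 1) → T) p (τ : Equiv.Perm (Fin n)),
      (Fin.cons (u p) (p.removeNth u ∘ τ) : Fin (n + 1) → T) = u ∘ κ p τ := by
    intro u p τ
    funext j
    refine Fin.cases ?_ (fun j => ?_) j
    · simp [κ, Fin.cycleRange_symm_zero]
    · simp [κ, Fin.cycleRange_symm_succ, Fin.removeNth]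
  have h1 : antisym f v = 0 := by
    have : (f : (Fin (n + 1) → T) → ℝ) = fun u => ∑ p : Fin (n + 1), (-1) ^ (p : ℕ) *
        ∑ τ : Equiv.Perm (Fin n), ((Equiv.Perm.sign τ : ℤ) : ℝ) * F (u ∘ κ p τ) := by
      funext u
      rw [h u]
      simp only [antisym, hκ]
    rw [this]
    simp only [antisym_sum, antisym_const_mul, antisym_comp_perm, hF, mul_zero,
      Finset.sum_const_zero]
  -- `f` is already alternating, so antisymmetrizing multiplies it by `(n + 1)!`.
  have h2 : antisym f v = ((n + 1).factorial : ℝ) * f v := by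
    have : ∀ ρ : Equiv.Perm (Fin (n + 1)),
        ((Equiv.Perm.sign ρ : ℤ) : ℝ) * f (v ∘ ρ) = f v := by
      intro ρ
      rw [f.map_perm, Units.smul_def, zsmul_eq_mul, ← mul_assoc]
      have : (((Equiv.Perm.sign ρ : ℤ) : ℝ) * ((Equiv.Perm.sign ρ : ℤ) : ℝ)) = 1 := by
        exact_mod_cast Int.units_coe_mul_self _
      rw [this, one_mul]
    simp only [antisym, this]
    simp [Fintype.card_perm]
  rw [h2] at h1
  simpa [Nat.factorial_ne_zero] using h1

end Antisymmetrization

section Pfaffian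

variable {m : ℕ}

/-- The value of the Pfaffian in terms of the polarised Pfaffian of real matrices. -/
theorem pfaffian_apply {T : Type*} [AddCommGroup T] [Module ℝ T] [TopologicalSpace T]
    (Ω : Matrix (Fin (2 * m)) (Fin (2 * m)) (T [⋀^Fin 2]→L[ℝ] ℝ)) (v : Fin (2 * m) → T) :
    pfaffian Ω v = ((2 : ℝ) ^ m * (m.factorial : ℝ))⁻¹ * (((2 : ℝ) ^ m)⁻¹ *
      antisym (fun u => polarPfaffian fun i => Matrix.of fun a b =>
        Ω a b ![u (pairIndex m ⟨i, 0⟩), u (pairIndex m ⟨i, 1⟩)]) v) := by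
  have h : ∀ (τ : Equiv.Perm (Fin (2 * m))) (i : Fin m),
      (fun b => v (τ (pairIndex m ⟨i, b⟩))) =
        ![v (τ (pairIndex m ⟨i, 0⟩)), v (τ (pairIndex m ⟨i, 1⟩))] := by
    intro τ i
    funext b
    fin_cases b <;> rfl
  simp only [pfaffian, wedgeTwo, ContinuousAlternatingMap.smul_apply, smul_eq_mul,
    ContinuousAlternatingMap.sum_apply, ContinuousMultilinearMap.alternatization_apply_apply,
    tensorTwo_apply, Function.comp_apply, h, antisym, polarPfaffian, Matrix.of_apply,
    Units.smul_def, zsmul_eq_mul]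
  congr 1
  simp only [Finset.mul_sum]
  rw [Finset.sum_comm]
  exact Finset.sum_congr rfl fun τ _ => Finset.sum_congr rfl fun σ _ => by ring

variable {E : Type*} [NormedAddCommGroup E] [NormedSpace ℝ E]

/-- The product rule for the Pfaffian and the Bianchi identity express `d Pf(Ω)` as the
antisymmetrization of `∑ i, Pf(Ω, …, [Ω, ω], …, Ω)`, which vanishes by invariance. -/
theorem extDeriv_eq_zero_of_eventually_eq_polarPfaffian
    {a : Fin (2 * m) → Fin (2 * m) → E → E →L[ℝ] ℝ} {y : E}
    (ha : ∀ i j, ContDiffAt ℝ ∞ (a i j) y)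
    (hskew : ∀ v w, (localCurvature a y v w).transpose = -localCurvature a y v w)
    {η : E → E [⋀^Fin (2 * m)]→L[ℝ] ℝ} (hη : DifferentiableAt ℝ η y) (c : ℝ)
    (h : ∀ᶠ z in 𝓝 y, ∀ v, η z v = c * antisym (fun u => polarPfaffian fun i =>
      localCurvature a z (u (pairIndex m ⟨i, 0⟩)) (u (pairIndex m ⟨i, 1⟩))) v) :
    extDeriv η y = 0 := by
  -- Argument `0` is the direction of differentiation; the others are fed to the curvature in pairs.
  -- `H i` is the term of the product rule in which the `i`-th factor is differentiated; cyclically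
  -- permuting argument `0` and the `i`-th pair turns it, by the Bianchi identity, into `Q i`.
  let X : (Fin (2 * m + 1) → E) → Fin m → Matrix (Fin (2 * m)) (Fin (2 * m)) ℝ := fun u i =>
    localCurvature a y (u (pairIndex m ⟨i, 0⟩).succ) (u (pairIndex m ⟨i, 1⟩).succ)
  let H : Fin m → (Fin (2 * m + 1) → E) → ℝ := fun i u => polarPfaffian (Function.update (X u) i
    (localCurvatureDeriv a y (u 0) (u (pairIndex m ⟨i, 0⟩).succ) (u (pairIndex m ⟨i, 1⟩).succ)))
  let Q : Fin m → (Fin (2 * m + 1) → E) → ℝ := fun i u => polarPfaffian (Function.update (X u) i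
    (X u i * formMatrix a y (u 0) - formMatrix a y (u 0) * X u i))
  have hHQ : ∀ i v, antisym (H i) v = antisym (Q i) v := by
    intro i
    have hij : (0 : Fin (2 * m + 1)) ≠ (pairIndex m ⟨i, 0⟩).succ := (Fin.succ_ne_zero _).symm
    have hik : (0 : Fin (2 * m + 1)) ≠ (pairIndex m ⟨i, 1⟩).succ := (Fin.succ_ne_zero _).symm
    have hjk : (pairIndex m ⟨i, 0⟩).succ ≠ (pairIndex m ⟨i, 1⟩).succ := by simp
    refine antisym_eq_of_cyclic_sum_eq hij hjk fun u => ?_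
    intro c
    have c0 : c 0 = (pairIndex m ⟨i, 0⟩).succ := by
      simp [c, Equiv.swap_apply_of_ne_of_ne hij hik]
    have c1 : c (pairIndex m ⟨i, 0⟩).succ = (pairIndex m ⟨i, 1⟩).succ := by
      simp [c, Equiv.swap_apply_of_ne_of_ne hik.symm hjk.symm]
    have c2 : c (pairIndex m ⟨i, 1⟩).succ = 0 := by simp [c]
    have cj : ∀ j, j ≠ i → ∀ b, c (pairIndex m ⟨j, b⟩).succ = (pairIndex m ⟨j, b⟩).succ := by
      intro j hj b
      have h1 : (pairIndex m ⟨j, b⟩).succ ≠ (pairIndex m ⟨i, 0⟩).succ := by simp [hj]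
      have h2 : (pairIndex m ⟨j, b⟩).succ ≠ (pairIndex m ⟨i, 1⟩).succ := by simp [hj]
      simp only [c, Equiv.Perm.coe_mul, Function.comp_apply,
        Equiv.swap_apply_of_ne_of_ne h1 h2, Equiv.swap_apply_of_ne_of_ne (Fin.succ_ne_zero _) h1]
    have hX : ∀ (u : Fin (2 * m + 1) → E) Y,
        Function.update (X (u ∘ c)) i Y = Function.update (X u) i Y := by
      intro u Y
      funext j
      by_cases hj : j = i
      · subst hj
        simp
      · simp [Function.update_of_ne hj, X, cj j hj]
    simp only [H, Q, hX, ← polarPfaffian_update_add]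
    simp only [X, Function.comp_apply, c0, c1, c2]
    rw [bianchi ha]
  have hZ : ∀ v, antisym (fun u => ∑ i, H i u) v = 0 := by
    intro v
    rw [antisym_sum]
    simp only [hHQ]
    rw [← antisym_sum]
    have hQ : (fun u => ∑ i, Q i u) = fun _ => 0 := by
      funext u
      exact sum_polarPfaffian_update_commutator (X u) (fun i => hskew _ _) _
    rw [hQ]
    simp [antisym]
  have hD : ∀ (v : Fin (2 * m) → E) (w : E), fderiv ℝ (fun z => η z v) y w =
      antisym (fun u => c * ∑ i, H i (Fin.cons w u)) v := by
    intro v w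
    have hK : ∀ v w : E, ∀ i j, HasFDerivAt (fun z => localCurvature a z v w i j)
        (fderiv ℝ (fun z => localCurvature a z v w i j) y) y := fun v w i j =>
      ((contDiffAt_localCurvature ha v w i j).differentiableAt (by simp)).hasFDerivAt
    choose L hL hL' using fun u : Fin (2 * m) → E => hasFDerivAt_polarPfaffian (m := m)
      (X := fun i z => localCurvature a z (u (pairIndex m ⟨i, 0⟩)) (u (pairIndex m ⟨i, 1⟩)))
      (fun i => hK _ _)
    have h1 := ((HasFDerivAt.fun_sum (u := Finset.univ) fun (τ : Equiv.Perm (Fin (2 * m))) _ =>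
      (hL (v ∘ τ)).const_mul ((Equiv.Perm.sign τ : ℤ) : ℝ)).const_mul c).congr_of_eventuallyEq
      (h.mono fun z hz => hz v)
    rw [h1.fderiv]
    simp only [FunLike.coe_smul, FunLike.coe_sum, Pi.smul_apply, Finset.sum_apply, smul_eq_mul,
      hL', antisym_const_mul]
    rfl
  apply ContinuousAlternatingMap.toAlternatingMap_injective
  refine alternating_eq_zero_of_antisym _ (F := fun u => c * ∑ i, H i u) (fun v => ?_) fun u => ?_
  · rw [antisym_const_mul, hZ, mul_zero]
  · refine (extDeriv_apply hη u).trans (Finset.sum_congr rfl fun p _ => ?_)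
    rw [hD, zsmul_eq_mul]
    simp

end Pfaffian

/-! ### Differential forms in charts -/

section Charts

variable {E : Type*} [NormedAddCommGroup E] [NormedSpace ℝ E]
  {M : Type*} [TopologicalSpace M] [ChartedSpace E M]

/-- The derivative of the inverse chart `φ⁻¹`, as a linear map on the model space. -/
def chartDeriv (φ : OpenPartialHomeomorph M E) (y : E) :
    E →L[ℝ] TangentSpace 𝓘(ℝ, E) (φ.symm y) :=
  mfderiv 𝓘(ℝ, E) 𝓘(ℝ, E) φ.symm y

theorem inChart_apply {k : ℕ} (φ : OpenPartialHomeomorph M E) (α : FormField E M k) (y : E)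
    (v : Fin k → E) : inChart φ α y v = α (φ.symm y) (fun i => chartDeriv φ y (v i)) := rfl

theorem FormField.apply_congr {k : ℕ} (α : FormField E M k) {x x' : M} (h : x = x')
    (v : Fin k → E) : α x v = α x' v := by
  subst h
  rfl

variable [IsManifold 𝓘(ℝ, E) ∞ M]

theorem chartDeriv_surjective {φ : OpenPartialHomeomorph M E} (hφ : φ ∈ atlas E M) {y : E}
    (hy : y ∈ φ.target) : Function.Surjective (chartDeriv φ y) :=
  (mdifferentiable_of_mem_atlas (I := 𝓘(ℝ, E)) hφ).symm.mfderiv_surjective hy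

theorem contDiffAt_transition {φ ψ : OpenPartialHomeomorph M E} (hφ : φ ∈ atlas E M)
    (hψ : ψ ∈ atlas E M) {y : E} (hy : y ∈ φ.target) (hy' : φ.symm y ∈ ψ.source) :
    ContDiffAt ℝ ∞ (ψ ∘ φ.symm) y := by
  rw [← contMDiffAt_iff_contDiffAt]
  exact (contMDiffAt_of_mem_maximalAtlas (I := 𝓘(ℝ, E))
    (IsManifold.subset_maximalAtlas hψ) hy').comp y
    (contMDiffAt_symm_of_mem_maximalAtlas (IsManifold.subset_maximalAtlas hφ) hy)

theorem mfderiv_chart_chartDeriv {φ ψ : OpenPartialHomeomorph M E} (hφ : φ ∈ atlas E M)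
    (hψ : ψ ∈ atlas E M) {y : E} (hy : y ∈ φ.target) (hy' : φ.symm y ∈ ψ.source) (v : E) :
    (mfderiv 𝓘(ℝ, E) 𝓘(ℝ, E) ψ (φ.symm y) (chartDeriv φ y v) : E) =
      fderiv ℝ (ψ ∘ φ.symm) y v := by
  rw [← mfderiv_eq_fderiv, mfderiv_comp (I' := 𝓘(ℝ, E)) y
    (mdifferentiableAt_atlas hψ hy') (mdifferentiableAt_atlas_symm hφ hy)]
  rfl

/-- The coordinate expressions of a form in two charts are related by pullback under the
transition map. -/
theorem inChart_eq_pullback {k : ℕ} (α : FormField E M k) {φ ψ : OpenPartialHomeomorph M E}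
    (hφ : φ ∈ atlas E M) (hψ : ψ ∈ atlas E M) {y : E} (hy : y ∈ φ.target)
    (hy' : φ.symm y ∈ ψ.source) :
    inChart φ α y = (inChart ψ α ((ψ ∘ φ.symm) y)).compContinuousLinearMap
      (fderiv ℝ (ψ ∘ φ.symm) y) := by
  have hev : φ.symm =ᶠ[𝓝 y] ψ.symm ∘ (ψ ∘ φ.symm) := by
    have h1 : ∀ᶠ z in 𝓝 y, φ.symm z ∈ ψ.source :=
      (φ.continuousAt_symm hy).eventually_mem (ψ.open_source.mem_nhds hy')
    filter_upwards [h1] with z hz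
    simp [hz]
  have h1 : ∀ v : E, (chartDeriv φ y v : E) =
      chartDeriv ψ ((ψ ∘ φ.symm) y) (fderiv ℝ (ψ ∘ φ.symm) y v) := by
    intro v
    have h2 := hev.mfderiv_eq (I := 𝓘(ℝ, E)) (I' := 𝓘(ℝ, E))
    rw [mfderiv_comp (I' := 𝓘(ℝ, E)) y
      (mdifferentiableAt_atlas_symm hψ (ψ.map_source hy'))
      ((contDiffAt_transition hφ hψ hy hy').differentiableAt (by simp)).mdifferentiableAt,
      mfderiv_eq_fderiv] at h2
    exact congrArg (fun L : E →L[ℝ] E => L v) h2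
  ext v
  rw [inChart_apply, ContinuousAlternatingMap.compContinuousLinearMap_apply, inChart_apply]
  refine (α.apply_congr hev.self_of_nhds _).trans ?_
  congr 1
  funext i
  exact h1 (v i)

/-- The exterior derivative may be computed in any chart. -/
theorem inChart_extD {k : ℕ} (α : FormField E M k) {φ : OpenPartialHomeomorph M E}
    (hφ : φ ∈ atlas E M) {y : E} (hy : y ∈ φ.target)
    (hα : DifferentiableAt ℝ (inChart (chartAt E (φ.symm y)) α)
      (chartAt E (φ.symm y) (φ.symm y))) :
    inChart φ (extD α) y = extDeriv (inChart φ α) y := by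
  set ψ := chartAt E (φ.symm y) with hψ'
  have hψ : ψ ∈ atlas E M := chart_mem_atlas E _
  have hy' : φ.symm y ∈ ψ.source := mem_chart_source E _
  have hev : inChart φ α =ᶠ[𝓝 y] fun z => (inChart ψ α ((ψ ∘ φ.symm) z)).compContinuousLinearMap
      (fderiv ℝ (ψ ∘ φ.symm) z) := by
    have h1 : ∀ᶠ z in 𝓝 y, φ.symm z ∈ ψ.source :=
      (φ.continuousAt_symm hy).eventually_mem (ψ.open_source.mem_nhds hy')
    filter_upwards [h1, φ.open_target.mem_nhds hy] with z hz hz'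
    exact inChart_eq_pullback α hφ hψ hz' hz
  rw [hev.extDeriv_eq, extDeriv_pullback (r := ∞) (f := ψ ∘ φ.symm) hα
    (contDiffAt_transition hφ hψ hy hy')
    (by simpa using WithTop.coe_le_coe.2 (le_top : (2 : ℕ∞) ≤ ⊤))]
  ext v
  rw [inChart_apply, ContinuousAlternatingMap.compContinuousLinearMap_apply]
  have h2 : (fun i => fderiv ℝ (ψ ∘ φ.symm) y (v i)) = fun i =>
      (mfderiv 𝓘(ℝ, E) 𝓘(ℝ, E) ψ (φ.symm y) (chartDeriv φ y (v i)) : E) :=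
    funext fun i => (mfderiv_chart_chartDeriv hφ hψ hy hy' (v i)).symm
  refine Eq.trans ?_ (congrArg (extDeriv (inChart ψ α) ((ψ ∘ φ.symm) y)) h2.symm)
  rfl

/-- On a finite-dimensional space, a field of alternating maps is smooth as soon as its values at
fixed vectors are. -/
theorem contDiffAt_alternating_of_apply {D : Type*} [NormedAddCommGroup D] [NormedSpace ℝ D]
    [FiniteDimensional ℝ E] {k : ℕ} {f : D → E [⋀^Fin k]→L[ℝ] ℝ} {y : D}
    (h : ∀ v, ContDiffAt ℝ ∞ (fun z => f z v) y) : ContDiffAt ℝ ∞ f y := by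
  -- Evaluation on tuples of basis vectors is injective, so it has a linear left inverse, which is
  -- continuous because its domain is finite-dimensional.
  let b := Module.finBasis ℝ E
  let ev : (E [⋀^Fin k]→L[ℝ] ℝ) →ₗ[ℝ] ((Fin k → Fin (finrank ℝ E)) → ℝ) :=
    { toFun := fun g s => g fun i => b (s i)
      map_add' := fun _ _ => rfl
      map_smul' := fun _ _ => rfl }
  have hev : LinearMap.ker ev = ⊥ := by
    rw [LinearMap.ker_eq_bot]
    intro g g' hg
    apply ContinuousAlternatingMap.toAlternatingMap_injective
    refine Basis.ext_alternating b fun s _ => congrFun hg s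
  obtain ⟨inv, hinv⟩ := ev.exists_leftInverse_of_injective hev
  have hf : f = fun z => LinearMap.toContinuousLinearMap inv (fun s => f z fun i => b (s i)) := by
    funext z
    exact (congrArg (fun L : (E [⋀^Fin k]→L[ℝ] ℝ) →ₗ[ℝ] _ => L (f z)) hinv).symm
  rw [hf]
  exact (LinearMap.toContinuousLinearMap inv).contDiff.contDiffAt.comp y
    (contDiffAt_pi.2 fun s => h _)

end Charts

/-! ### Local frames and connection forms -/

section Frames

variable {E : Type*} [NormedAddCommGroup E] [NormedSpace ℝ E]
  {M : Type*} [TopologicalSpace M] [ChartedSpace E M]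
  {F : Type*} [NormedAddCommGroup F] [NormedSpace ℝ F]
  {V : M → Type*} [TopologicalSpace (TotalSpace F V)]
  [∀ x, AddCommGroup (V x)] [∀ x, Module ℝ (V x)] [∀ x, TopologicalSpace (V x)]
  [FiberBundle F V] [VectorBundle ℝ F V]
  {r : ℕ} {u : Set M} {s : Fin r → (x : M) → V x}

/-- The coefficients, in a smooth local frame, of a smooth section along a smooth map are smooth:
in a trivialization the frame is a smooth family of isomorphisms `ℝʳ ≃ F`, and inversion of
isomorphisms is smooth. -/
theorem contMDiffAt_frame_coeff {D : Type*} [NormedAddCommGroup D] [NormedSpace ℝ D]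
    {N : Type*} [TopologicalSpace N] [ChartedSpace D N]
    (hs : IsLocalFrameOn 𝓘(ℝ, E) F ∞ s u) (hu : IsOpen u) {b : N → M} {t : ∀ y, V (b y)} {y : N}
    (hy : b y ∈ u)
    (ht : ContMDiffAt 𝓘(ℝ, D) (𝓘(ℝ, E).prod 𝓘(ℝ, F)) ∞
      (fun z => (⟨b z, t z⟩ : TotalSpace F V)) y) (i : Fin r) :
    ContMDiffAt 𝓘(ℝ, D) 𝓘(ℝ, ℝ) ∞ (fun z => hs.coeff i (b z) (t z)) y := by
  obtain ⟨hb, ht2⟩ := contMDiffAt_totalSpace.1 ht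
  let e := trivializationAt F V (b y)
  have hs2 : ∀ j, ContMDiffAt 𝓘(ℝ, D) 𝓘(ℝ, F) ∞ (fun z => (e ⟨b z, s j (b z)⟩).2) y := by
    intro j
    have h1 : ContMDiffAt 𝓘(ℝ, D) (𝓘(ℝ, E).prod 𝓘(ℝ, F)) ∞
        (fun z => (⟨b z, s j (b z)⟩ : TotalSpace F V)) y :=
      ContMDiffAt.comp y (g := fun x => (⟨x, s j x⟩ : TotalSpace F V))
        (hs.contMDiffAt hu hy j) hb
    exact (contMDiffAt_totalSpace.1 h1).2
  have hmem : ∀ z, b z ∈ u → b z ∈ e.baseSet → ∃ L : (Fin r → ℝ) ≃L[ℝ] F,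
      (L : (Fin r → ℝ) →L[ℝ] F) = ∑ j, (ContinuousLinearMap.smulRightL ℝ (Fin r → ℝ) F
        (ContinuousLinearMap.proj j)) (e ⟨b z, s j (b z)⟩).2 ∧
      ∀ i, hs.coeff i (b z) (t z) = L.symm (e ⟨b z, t z⟩).2 i := by
    intro z hz hz'
    let B := (hs.toBasisAt hz)
    refine ⟨(B.equivFun.symm.trans (e.linearEquivAt ℝ (b z) hz')).toContinuousLinearEquiv,
      ?_, fun i => ?_⟩
    · ext c
      simp [B, Basis.equivFun_symm_apply]
    · have : (e ⟨b z, t z⟩).2 = e.linearEquivAt ℝ (b z) hz' (t z) := rfl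
      rw [this]
      simp only [IsLocalFrameOn.coeff, hz, dif_pos]
      change _ = B.equivFun ((e.linearEquivAt ℝ (b z) hz').symm
        (e.linearEquivAt ℝ (b z) hz' (t z))) i
      rw [LinearEquiv.symm_apply_apply]
      rfl
  let S : N → (Fin r → ℝ) →L[ℝ] F := fun z =>
    ∑ j, (ContinuousLinearMap.smulRightL ℝ (Fin r → ℝ) F
      (ContinuousLinearMap.proj j)) (e ⟨b z, s j (b z)⟩).2
  have hS : ContMDiffAt 𝓘(ℝ, D) 𝓘(ℝ, (Fin r → ℝ) →L[ℝ] F) ∞ S y := by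
    refine contMDiffAt_finsetSum fun j _ => ?_
    exact (ContinuousLinearMap.contDiff _).contDiffAt.comp_contMDiffAt (hs2 j)
  have hev : (fun z => hs.coeff i (b z) (t z)) =ᶠ[𝓝 y] fun z =>
      ContinuousLinearMap.proj (R := ℝ) (φ := fun _ : Fin r => ℝ) i
        (ContinuousLinearMap.inverse (S z) (e ⟨b z, t z⟩).2) := by
    filter_upwards [hb.continuousAt.eventually_mem (hu.mem_nhds hy),
      hb.continuousAt.eventually_mem (e.open_baseSet.mem_nhds
        (FiberBundle.mem_baseSet_trivializationAt' (b y)))] with z hz hz'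
    obtain ⟨L, hL, hL'⟩ := hmem z hz hz'
    rw [hL' i, show S z = L from hL.symm, ContinuousLinearMap.inverse_equiv]
    rfl
  refine ContMDiffAt.congr_of_eventuallyEq ?_ hev
  obtain ⟨L, hL, -⟩ := hmem y hy (FiberBundle.mem_baseSet_trivializationAt' (b y))
  have hinv : ContMDiffAt 𝓘(ℝ, D) 𝓘(ℝ, F →L[ℝ] (Fin r → ℝ)) ∞
      (fun z => ContinuousLinearMap.inverse (S z)) y := by
    have h1 : ContDiffAt ℝ ∞ (ContinuousLinearMap.inverse : ((Fin r → ℝ) →L[ℝ] F) → _) (S y) := by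
      rw [show S y = L from hL.symm]
      exact contDiffAt_map_inverse L
    exact h1.comp_contMDiffAt hS
  exact (ContinuousLinearMap.contDiff _).contDiffAt.comp_contMDiffAt (hinv.clm_apply ht2)

omit [VectorBundle ℝ F V] in
theorem mdifferentiableAt_frame (hs : IsLocalFrameOn 𝓘(ℝ, E) F ∞ s u) (hu : IsOpen u) {x : M}
    (hx : x ∈ u) (j : Fin r) :
    MDifferentiableAt 𝓘(ℝ, E) (𝓘(ℝ, E).prod 𝓘(ℝ, F)) (fun x => (⟨x, s j x⟩ : TotalSpace F V)) x :=
  (hs.contMDiffAt hu hx j).mdifferentiableAt (by simp)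

variable [FiniteDimensional ℝ E] [T2Space M] [IsManifold 𝓘(ℝ, E) ∞ M]

/-- A local section that is smooth on an open set agrees near each point of that set with a
global smooth section. -/
theorem exists_contMDiff_section_eventuallyEq {t : ∀ x : M, V x} (hu : IsOpen u)
    (ht : ContMDiffOn 𝓘(ℝ, E) (𝓘(ℝ, E).prod 𝓘(ℝ, F)) ∞
      (fun x => (⟨x, t x⟩ : TotalSpace F V)) u) {x : M} (hx : x ∈ u) :
    ∃ σ : ∀ x : M, V x, ContMDiff 𝓘(ℝ, E) (𝓘(ℝ, E).prod 𝓘(ℝ, F)) ∞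
      (fun x => (⟨x, σ x⟩ : TotalSpace F V)) ∧ ∀ᶠ z in 𝓝 x, σ z = t z := by
  obtain ⟨f, -, hf⟩ := (SmoothBumpFunction.nhds_basis_tsupport (I := 𝓘(ℝ, E)) x).mem_iff.1
    (hu.mem_nhds hx)
  refine ⟨(f : M → ℝ) • t, f.contMDiff.contMDiffOn.smul_section_of_tsupport hu hf ht, ?_⟩
  filter_upwards [f.eventuallyEq_one] with z hz
  simp [hz]

end Frames

section ConnectionForms

variable {E : Type*} [NormedAddCommGroup E] [NormedSpace ℝ E] [FiniteDimensional ℝ E]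
  {M : Type*} [TopologicalSpace M] [ChartedSpace E M] [T2Space M] [IsManifold 𝓘(ℝ, E) ∞ M]
  {F : Type*} [NormedAddCommGroup F] [NormedSpace ℝ F]
  {V : M → Type*} [TopologicalSpace (TotalSpace F V)]
  [∀ x, AddCommGroup (V x)] [∀ x, Module ℝ (V x)] [∀ x, TopologicalSpace (V x)]
  [∀ x, IsTopologicalAddGroup (V x)] [∀ x, ContinuousSMul ℝ (V x)]
  [FiberBundle F V] [VectorBundle ℝ F V]
  {r : ℕ} {u : Set M} {s : Fin r → (x : M) → V x}

/-- The connection forms of a local frame, read in the chart `φ`. -/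
def connectionInChart (cov : CovariantDerivative 𝓘(ℝ, E) F V)
    (hs : IsLocalFrameOn 𝓘(ℝ, E) F ∞ s u) (φ : OpenPartialHomeomorph M E) (i j : Fin r) (y : E) :
    E →L[ℝ] ℝ :=
  (connectionForm cov hs i j (φ.symm y)).comp (chartDeriv φ y)

omit [FiniteDimensional ℝ E] [T2Space M] in
theorem contMDiffAt_chartDeriv_apply {φ : OpenPartialHomeomorph M E} (hφ : φ ∈ atlas E M) {y : E}
    (hy : y ∈ φ.target) (v : E) :
    ContMDiffAt 𝓘(ℝ, E) (𝓘(ℝ, E).prod 𝓘(ℝ, E)) ∞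
      (fun z => (⟨φ.symm z, chartDeriv φ z v⟩ : TangentBundle 𝓘(ℝ, E) M)) y := by
  have h1 := ((contMDiffOn_symm_of_mem_maximalAtlas (I := 𝓘(ℝ, E)) (n := ∞)
    (IsManifold.subset_maximalAtlas hφ)).contMDiffOn_tangentMapWithin (m := ∞) (by simp)
    φ.open_target.uniqueMDiffOn)
  have h2 : ContMDiffAt 𝓘(ℝ, E) 𝓘(ℝ, E).tangent ∞
      (fun z : E => (⟨z, v⟩ : TangentBundle 𝓘(ℝ, E) E)) y :=
    contMDiffAt_vectorSpace_iff_contDiffAt.2 contDiffAt_const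
  have h3 : ContMDiffAt 𝓘(ℝ, E) 𝓘(ℝ, E).tangent ∞ (fun z : E =>
      tangentMapWithin 𝓘(ℝ, E) 𝓘(ℝ, E) φ.symm φ.target (⟨z, v⟩ : TangentBundle 𝓘(ℝ, E) E)) y := by
    refine ContMDiffAt.comp y (h1.contMDiffAt ?_) h2
    exact ((FiberBundle.continuous_proj E (TangentSpace 𝓘(ℝ, E) (M := E))).isOpen_preimage _
      φ.open_target).mem_nhds hy
  refine h3.congr_of_eventuallyEq ?_
  filter_upwards [φ.open_target.mem_nhds hy] with z hz
  rw [tangentMapWithin, mfderivWithin_of_isOpen φ.open_target hz]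
  rfl

theorem contDiffAt_connectionInChart (cov : CovariantDerivative 𝓘(ℝ, E) F V)
    [CovariantDerivative.ContMDiffCovariantDerivative cov ∞]
    (hs : IsLocalFrameOn 𝓘(ℝ, E) F ∞ s u) (hu : IsOpen u) {φ : OpenPartialHomeomorph M E}
    (hφ : φ ∈ atlas E M) {y : E} (hy : y ∈ φ.target) (hyu : φ.symm y ∈ u) (i j : Fin r) :
    ContDiffAt ℝ ∞ (connectionInChart cov hs φ i j) y := by
  have hO : IsOpen (φ.target ∩ φ.symm ⁻¹' u) := φ.isOpen_inter_preimage_symm hu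
  refine (contDiffOn_clm_apply.2 fun v => ?_ :
    ContDiffOn ℝ ∞ (connectionInChart cov hs φ i j) (φ.target ∩ φ.symm ⁻¹' u)).contDiffAt
      (hO.mem_nhds ⟨hy, hyu⟩)
  rintro y ⟨hy, hyu⟩
  apply ContDiffAt.contDiffWithinAt
  -- Smoothness of `cov` concerns globally smooth sections, so `s j` is replaced by a global
  -- section `σ` with the same germ.
  obtain ⟨σ, hσ, hσs⟩ := exists_contMDiff_section_eventuallyEq hu (hs.contMDiffOn j) hyu
  have hcov := (CovariantDerivative.ContMDiffCovariantDerivative.contMDiff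
    (cov := cov) (k := ∞)).contMDiff (σ := σ) (by simpa using hσ.contMDiffOn)
  have h1 := ((hcov.contMDiffAt Filter.univ_mem).comp y
    (contMDiffAt_symm_of_mem_maximalAtlas (I := 𝓘(ℝ, E)) (n := ∞)
      (IsManifold.subset_maximalAtlas hφ) hy)).clm_bundle_apply
      (contMDiffAt_chartDeriv_apply hφ hy v)
  have h2 := contMDiffAt_iff_contDiffAt.1 (contMDiffAt_frame_coeff hs hu hyu h1 i)
  refine h2.congr_of_eventuallyEq ?_
  filter_upwards [hO.mem_nhds ⟨hy, hyu⟩,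
    (φ.continuousAt_symm hy).eventually hσs.eventually_nhds] with z hz hz'
  have h3 : cov σ (φ.symm z) = cov (s j) (φ.symm z) :=
    cov.isCovariantDerivativeOnUniv.congr_of_eventuallyEq
      (hσ.contMDiffAt.mdifferentiableAt (by simp)) (mdifferentiableAt_frame hs hu hz.2 j)
      Filter.univ_mem hz'
  rw [h3]
  rfl

end ConnectionForms

/-! ### Curvature matrices: coordinate expression and change of frame -/

section Curvature

variable {E : Type*} [NormedAddCommGroup E] [NormedSpace ℝ E] [FiniteDimensional ℝ E]
  {M : Type*} [TopologicalSpace M] [ChartedSpace E M]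
  {F : Type*} [NormedAddCommGroup F] [NormedSpace ℝ F]
  {V : M → Type*} [TopologicalSpace (TotalSpace F V)]
  [∀ x, AddCommGroup (V x)] [∀ x, Module ℝ (V x)] [∀ x, TopologicalSpace (V x)]
  [∀ x, IsTopologicalAddGroup (V x)] [∀ x, ContinuousSMul ℝ (V x)]
  [FiberBundle F V]
  {r : ℕ} {u u' : Set M} {s s' : Fin r → (x : M) → V x}

/-- A connection form as a field of alternating `1`-forms. -/
def connectionField (cov : CovariantDerivative 𝓘(ℝ, E) F V)
    (hs : IsLocalFrameOn 𝓘(ℝ, E) F ∞ s u) (i j : Fin r) : FormField E M 1 := fun y =>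
  ContinuousAlternatingMap.ofSubsingleton ℝ (TangentSpace 𝓘(ℝ, E) y) ℝ (0 : Fin 1)
    (connectionForm cov hs i j y)

theorem curvatureMatrix_apply (cov : CovariantDerivative 𝓘(ℝ, E) F V)
    (hs : IsLocalFrameOn 𝓘(ℝ, E) F ∞ s u) (x : M) (i j : Fin r) :
    curvatureMatrix cov hs x i j = extD (connectionField cov hs i j) x +
      ∑ k, wedgeOne (connectionForm cov hs i k x) (connectionForm cov hs k j x) := rfl

theorem connectionForm_apply (cov : CovariantDerivative 𝓘(ℝ, E) F V)
    (hs : IsLocalFrameOn 𝓘(ℝ, E) F ∞ s u) (i j : Fin r) (x : M) (v : TangentSpace 𝓘(ℝ, E) x) :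
    connectionForm cov hs i j x v = hs.coeff i x (cov (s j) x v) := rfl

omit [FiniteDimensional ℝ E] [∀ x, IsTopologicalAddGroup (V x)]
  [∀ x, ContinuousSMul ℝ (V x)] in
theorem sum_coeff_smul_frame (hs : IsLocalFrameOn 𝓘(ℝ, E) F ∞ s u) {x : M} (hx : x ∈ u)
    (w : V x) : ∑ i, hs.coeff i x w • s i x = w := by
  simpa [IsLocalFrameOn.coeff, hx] using (hs.toBasisAt hx).sum_repr w

omit [FiniteDimensional ℝ E] in
theorem cov_sum_smul [VectorBundle ℝ F V] (cov : CovariantDerivative 𝓘(ℝ, E) F V) {x : M}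
    {g : Fin r → M → ℝ} (hg : ∀ i, MDifferentiableAt 𝓘(ℝ, E) 𝓘(ℝ, ℝ) (g i) x)
    (hs : ∀ i, MDifferentiableAt 𝓘(ℝ, E) (𝓘(ℝ, E).prod 𝓘(ℝ, F))
      (fun x => (⟨x, s i x⟩ : TotalSpace F V)) x) (S : Finset (Fin r)) :
    MDifferentiableAt 𝓘(ℝ, E) (𝓘(ℝ, E).prod 𝓘(ℝ, F))
      (fun x => (⟨x, (∑ i ∈ S, g i • s i) x⟩ : TotalSpace F V)) x ∧
    cov (∑ i ∈ S, g i • s i) x =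
      ∑ i ∈ S, (g i x • cov (s i) x + (mvfderiv 𝓘(ℝ, E) (g i) x).smulRight (s i x)) := by
  induction S using Finset.induction_on with
  | empty =>
    refine ⟨?_, ?_⟩
    · exact mdifferentiableAt_zeroSection ℝ V
    · simp
  | insert i S hi ih =>
    have h1 := (hg i).smul_section (hs i)
    rw [Finset.sum_insert hi, Finset.sum_insert hi]
    refine ⟨mdifferentiableAt_add_section h1 ih.1, ?_⟩
    rw [cov.isCovariantDerivativeOnUniv.add h1 ih.1, ih.2,
      cov.isCovariantDerivativeOnUniv.leibniz (hs i) (hg i)]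

/-- The change of connection forms under a change of frame, `g ω' = ω g + dg`, where the columns of
`g` are the coefficients of the new frame `s'` in the old frame `s`. -/
theorem sum_coeff_mul_connectionForm [VectorBundle ℝ F V]
    (cov : CovariantDerivative 𝓘(ℝ, E) F V)
    (hs : IsLocalFrameOn 𝓘(ℝ, E) F ∞ s u) (hs' : IsLocalFrameOn 𝓘(ℝ, E) F ∞ s' u')
    (hu : IsOpen u) (hu' : IsOpen u') {x : M} (hx : x ∈ u) (hx' : x ∈ u')
    (v : TangentSpace 𝓘(ℝ, E) x) (i j : Fin r) :
    ∑ k, hs.coeff i x (s' k x) * connectionForm cov hs' k j x v =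
      ∑ k, connectionForm cov hs i k x v * hs.coeff k x (s' j x) +
        mvfderiv 𝓘(ℝ, E) (fun z => hs.coeff i z (s' j z)) x v := by
  have hg : ∀ k, MDifferentiableAt 𝓘(ℝ, E) 𝓘(ℝ, ℝ) (fun z => hs.coeff k z (s' j z)) x := fun k =>
    (contMDiffAt_frame_coeff (b := id) hs hu hx (hs'.contMDiffAt hu' hx' j) k).mdifferentiableAt
      (by simp)
  obtain ⟨h1, h2⟩ := cov_sum_smul cov hg (fun i => mdifferentiableAt_frame hs hu hx i) Finset.univ
  have h3 : cov (s' j) x = cov (∑ k, (fun z => hs.coeff k z (s' j z)) • s k) x := by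
    refine cov.isCovariantDerivativeOnUniv.congr_of_eventuallyEq
      (mdifferentiableAt_frame hs' hu' hx' j) h1 Filter.univ_mem ?_
    filter_upwards [hu.mem_nhds hx] with z hz
    rw [Finset.sum_apply]
    exact (sum_coeff_smul_frame hs hz (s' j z)).symm
  have h4 : hs.coeff i x (cov (s' j) x v) =
      ∑ k, hs.coeff i x (s' k x) * connectionForm cov hs' k j x v := by
    conv_lhs => rw [← sum_coeff_smul_frame hs' hx' (cov (s' j) x v)]
    simp only [map_sum, map_smul, smul_eq_mul, connectionForm_apply]
    exact Finset.sum_congr rfl fun k _ => mul_comm _ _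
  rw [← h4, h3, h2]
  have h5 : ∀ k, hs.coeff i x (s k x) = if k = i then 1 else 0 := by
    intro k
    rw [hs.coeff_apply_of_mem hx (s k), ← hs.toBasisAt_coe hx k, Basis.repr_self,
      Finsupp.single_apply]
  simp only [FunLike.coe_sum, Finset.sum_apply, FunLike.coe_add, Pi.add_apply, FunLike.coe_smul,
    Pi.smul_apply, map_sum, map_add, map_smul, smul_eq_mul, ContinuousLinearMap.smulRight_apply,
    Finset.sum_add_distrib, h5, connectionForm_apply]
  simp [mul_comm]

/-- Permuting the vectors of a frame permutes the entries of the curvature matrix. -/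
theorem curvatureMatrix_comp_perm (cov : CovariantDerivative 𝓘(ℝ, E) F V)
    (hs : IsLocalFrameOn 𝓘(ℝ, E) F ∞ s u) (κ : Equiv.Perm (Fin r))
    (hs' : IsLocalFrameOn 𝓘(ℝ, E) F ∞ (fun i => s (κ i)) u) (x : M) (i j : Fin r) :
    curvatureMatrix cov hs' x i j = curvatureMatrix cov hs x (κ i) (κ j) := by
  have h1 : ∀ i x, hs'.coeff i x = hs.coeff (κ i) x := by
    intro i x
    by_cases hx : x ∈ u
    · have : hs'.toBasisAt hx = (hs.toBasisAt hx).reindex κ.symm := by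
        ext j
        simp
      ext w
      simp [IsLocalFrameOn.coeff, hx, this]
    · simp [IsLocalFrameOn.coeff, hx]
  have h2 : ∀ i j, connectionForm cov hs' i j = connectionForm cov hs (κ i) (κ j) := by
    intro i j
    funext x
    ext v
    rw [connectionForm_apply, connectionForm_apply, h1]
  have h3 : connectionField cov hs' i j = connectionField cov hs (κ i) (κ j) := by
    funext y
    simp only [connectionField, h2]
  rw [curvatureMatrix_apply, curvatureMatrix_apply, h3]
  simp only [h2]
  refine congrArg _ ?_
  exact Equiv.sum_comp κ fun k =>
    wedgeOne (connectionForm cov hs (κ i) k x) (connectionForm cov hs k (κ j) x)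

variable [T2Space M] [IsManifold 𝓘(ℝ, E) ∞ M] [VectorBundle ℝ F V]

omit [T2Space M] [IsManifold 𝓘(ℝ, E) ∞ M] [VectorBundle ℝ F V] in
theorem inChart_connectionField (cov : CovariantDerivative 𝓘(ℝ, E) F V)
    (hs : IsLocalFrameOn 𝓘(ℝ, E) F ∞ s u) (φ : OpenPartialHomeomorph M E) (i j : Fin r) (y : E)
    (v : Fin 1 → E) :
    inChart φ (connectionField cov hs i j) y v = connectionInChart cov hs φ i j y (v 0) := rfl

theorem contDiffAt_inChart_connectionField (cov : CovariantDerivative 𝓘(ℝ, E) F V)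
    [CovariantDerivative.ContMDiffCovariantDerivative cov ∞]
    (hs : IsLocalFrameOn 𝓘(ℝ, E) F ∞ s u) (hu : IsOpen u) {φ : OpenPartialHomeomorph M E}
    (hφ : φ ∈ atlas E M) {y : E} (hy : y ∈ φ.target) (hyu : φ.symm y ∈ u) (i j : Fin r) :
    ContDiffAt ℝ ∞ (inChart φ (connectionField cov hs i j)) y :=
  contDiffAt_alternating_of_apply fun _ =>
    (contDiffAt_connectionInChart cov hs hu hφ hy hyu i j).clm_apply contDiffAt_const

/-- In any chart the curvature matrix is `dω + ω ∧ ω` for the coordinate expression of `ω`. -/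
theorem curvatureMatrix_chartDeriv (cov : CovariantDerivative 𝓘(ℝ, E) F V)
    [CovariantDerivative.ContMDiffCovariantDerivative cov ∞]
    (hs : IsLocalFrameOn 𝓘(ℝ, E) F ∞ s u) (hu : IsOpen u) {φ : OpenPartialHomeomorph M E}
    (hφ : φ ∈ atlas E M) {y : E} (hy : y ∈ φ.target) (hyu : φ.symm y ∈ u) (i j : Fin r)
    (v w : E) :
    curvatureMatrix cov hs (φ.symm y) i j ![chartDeriv φ y v, chartDeriv φ y w] =
      localCurvature (connectionInChart cov hs φ) y v w i j := by
  have hd := (contDiffAt_inChart_connectionField cov hs hu hφ hy hyu i j).differentiableAt (by simp)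
  have hd' := (contDiffAt_connectionInChart cov hs hu hφ hy hyu i j).differentiableAt (by simp)
  have hψ : φ.symm y ∈ (chartAt E (φ.symm y)).source := mem_chart_source E _
  have h1 := inChart_extD (connectionField cov hs i j) hφ hy
    ((contDiffAt_inChart_connectionField cov hs hu (chart_mem_atlas E (φ.symm y))
      ((chartAt E (φ.symm y)).map_source hψ)
      (by rwa [(chartAt E (φ.symm y)).left_inv hψ]) i j).differentiableAt (by simp))
  have h2 : extD (connectionField cov hs i j) (φ.symm y) ![chartDeriv φ y v, chartDeriv φ y w] =
      inChart φ (extD (connectionField cov hs i j)) y ![v, w] := by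
    rw [inChart_apply]
    congr 1
    funext b
    fin_cases b <;> rfl
  have h3 : ∀ v w : E, fderiv ℝ (fun z => connectionInChart cov hs φ i j z w) y v =
      fderiv ℝ (connectionInChart cov hs φ i j) y v w := by
    intro v w
    rw [fderiv_clm_apply hd' (differentiableAt_const w)]
    simp
  rw [curvatureMatrix_apply, localCurvature_apply, ContinuousAlternatingMap.add_apply, h2, h1,
    extDeriv_apply hd, ContinuousAlternatingMap.sum_apply, ← Finset.sum_sub_distrib]
  simp only [inChart_connectionField]
  congr 1
  · rw [← h3, ← h3]
    simp [Fin.removeNth, sub_eq_add_neg]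
  · exact Finset.sum_congr rfl fun k _ => wedgeOne_apply _ _ _

/-- Under a change of frame the curvature matrix is conjugated, `g Ω' = Ω g`. -/
theorem sum_coeff_mul_curvatureMatrix (cov : CovariantDerivative 𝓘(ℝ, E) F V)
    [CovariantDerivative.ContMDiffCovariantDerivative cov ∞]
    (hs : IsLocalFrameOn 𝓘(ℝ, E) F ∞ s u) (hs' : IsLocalFrameOn 𝓘(ℝ, E) F ∞ s' u')
    (hu : IsOpen u) (hu' : IsOpen u') {x : M} (hx : x ∈ u) (hx' : x ∈ u')
    (v w : TangentSpace 𝓘(ℝ, E) x) :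
    (Matrix.of fun i j => hs.coeff i x (s' j x)) *
        (Matrix.of fun i j => curvatureMatrix cov hs' x i j ![v, w]) =
      (Matrix.of fun i j => curvatureMatrix cov hs x i j ![v, w]) *
        (Matrix.of fun i j => hs.coeff i x (s' j x)) := by
  obtain ⟨φ, hφ, y, hy, rfl⟩ : ∃ φ ∈ atlas E M, ∃ y ∈ φ.target, φ.symm y = x :=
    ⟨chartAt E x, chart_mem_atlas E x, chartAt E x x, mem_chart_target E x,
      (chartAt E x).left_inv (mem_chart_source E x)⟩
  obtain ⟨v, rfl⟩ := chartDeriv_surjective hφ hy v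
  obtain ⟨w, rfl⟩ := chartDeriv_surjective hφ hy w
  simp only [curvatureMatrix_chartDeriv cov hs hu hφ hy hx,
    curvatureMatrix_chartDeriv cov hs' hu' hφ hy hx']
  have hg : ∀ {z}, φ.symm z ∈ u → φ.symm z ∈ u' → ∀ i j, ContMDiffAt 𝓘(ℝ, E) 𝓘(ℝ, ℝ) ∞
      (fun x => hs.coeff i x (s' j x)) (φ.symm z) := fun hx hx' i j =>
    contMDiffAt_frame_coeff (b := id) hs hu hx (hs'.contMDiffAt hu' hx' j) i
  refine mul_localCurvature_of_gauge (a := connectionInChart cov hs φ)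
    (a' := connectionInChart cov hs' φ)
    (g := fun z => Matrix.of fun i j => hs.coeff i (φ.symm z) (s' j (φ.symm z)))
    (fun i j => (contDiffAt_connectionInChart cov hs hu hφ hy hx i j).differentiableAt (by simp))
    (fun i j => (contDiffAt_connectionInChart cov hs' hu' hφ hy hx' i j).differentiableAt (by simp))
    (fun i j => ?_) ?_ v w
  · exact contMDiffAt_iff_contDiffAt.1 ((hg hx hx' i j).comp y
      (contMDiffAt_symm_of_mem_maximalAtlas (I := 𝓘(ℝ, E)) (IsManifold.subset_maximalAtlas hφ) hy))
  · filter_upwards [φ.open_target.mem_nhds hy,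
      (φ.continuousAt_symm hy).eventually_mem (hu.mem_nhds hx),
      (φ.continuousAt_symm hy).eventually_mem (hu'.mem_nhds hx')] with z hz hzu hzu' v
    ext i j
    simp only [Matrix.mul_apply, Matrix.add_apply, formMatrix, Matrix.of_apply]
    refine (sum_coeff_mul_connectionForm cov hs hs' hu hu' hzu hzu' (chartDeriv φ z v) i j).trans ?_
    congr 1
    have h1 := mfderiv_comp (I'' := 𝓘(ℝ, ℝ)) z
      ((hg hzu hzu' i j).mdifferentiableAt (by simp)) (mdifferentiableAt_atlas_symm hφ hz)
    rw [mfderiv_eq_fderiv] at h1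
    exact (congrArg (fun L : E →L[ℝ] ℝ => L v) h1).symm

end Curvature

/-! ### The Euler form -/

section EulerForm

variable {E : Type*} [NormedAddCommGroup E] [NormedSpace ℝ E] [FiniteDimensional ℝ E]
  {M : Type*} [TopologicalSpace M] [ChartedSpace E M] [T2Space M] [IsManifold 𝓘(ℝ, E) ∞ M]
  {F : Type*} [NormedAddCommGroup F] [NormedSpace ℝ F]
  {V : M → Type*} [TopologicalSpace (TotalSpace F V)]
  [∀ x, AddCommGroup (V x)] [∀ x, Module ℝ (V x)] [∀ x, TopologicalSpace (V x)]
  [∀ x, IsTopologicalAddGroup (V x)] [∀ x, ContinuousSMul ℝ (V x)]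
  [FiberBundle F V] [VectorBundle ℝ F V]
  {r m : ℕ} {u u' : Set M}

omit [FiniteDimensional ℝ E] [T2Space M] [IsManifold 𝓘(ℝ, E) ∞ M]
  [∀ x, IsTopologicalAddGroup (V x)] [∀ x, ContinuousSMul ℝ (V x)] [VectorBundle ℝ F V] in
theorem det_coeff_eq_basis_det {s s' : Fin r → (x : M) → V x}
    (hs : IsLocalFrameOn 𝓘(ℝ, E) F ∞ s u) {x : M} (hx : x ∈ u) :
    (Matrix.of fun i j => hs.coeff i x (s' j x)).det =
      (hs.toBasisAt hx).det (fun j => s' j x) := by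
  rw [Basis.det_apply]
  congr 1
  ext i j
  rw [Basis.toMatrix_apply, Matrix.of_apply]
  exact hs.coeff_apply_of_mem hx (s' j) i

omit [FiniteDimensional ℝ E] [T2Space M] [IsManifold 𝓘(ℝ, E) ∞ M]
  [∀ x, IsTopologicalAddGroup (V x)] [∀ x, ContinuousSMul ℝ (V x)] [VectorBundle ℝ F V] in
theorem orientation_eq_iff_det_coeff_pos {s s' : Fin r → (x : M) → V x}
    (hs : IsLocalFrameOn 𝓘(ℝ, E) F ∞ s u) (hs' : IsLocalFrameOn 𝓘(ℝ, E) F ∞ s' u') {x : M}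
    (hx : x ∈ u) (hx' : x ∈ u') :
    (hs.toBasisAt hx).orientation = (hs'.toBasisAt hx').orientation ↔
      0 < (Matrix.of fun i j => hs.coeff i x (s' j x)).det := by
  rw [det_coeff_eq_basis_det hs hx, Basis.orientation_eq_iff_det_pos]
  simp only [show ⇑(hs'.toBasisAt hx') = fun j => s' j x from funext (hs'.toBasisAt_coe hx')]

omit [FiniteDimensional ℝ E] [T2Space M] [IsManifold 𝓘(ℝ, E) ∞ M]
  [∀ x, IsTopologicalAddGroup (V x)] [∀ x, ContinuousSMul ℝ (V x)] in
theorem continuousAt_det_coeff {s s' : Fin r → (x : M) → V x}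
    (hs : IsLocalFrameOn 𝓘(ℝ, E) F ∞ s u) (hs' : IsLocalFrameOn 𝓘(ℝ, E) F ∞ s' u')
    (hu : IsOpen u) (hu' : IsOpen u') {x : M} (hx : x ∈ u) (hx' : x ∈ u') :
    ContinuousAt (fun z => (Matrix.of fun i j => hs.coeff i z (s' j z)).det) x := by
  refine (Continuous.matrix_det continuous_id).continuousAt.comp
    (continuousAt_pi.2 fun i => continuousAt_pi.2 fun j => ?_)
  exact (contMDiffAt_frame_coeff (b := id) hs hu hx (hs'.contMDiffAt hu' hx' j) i).continuousAt

variable (cov : CovariantDerivative 𝓘(ℝ, E) F V)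

section Restriction

variable [CovariantDerivative.ContMDiffCovariantDerivative cov ∞]

/-- Skew-symmetry of the curvature is inherited by the restriction of a frame to a smaller open set;
this is the change of frame with transition matrix `1`. -/
theorem HasSkewCurvature.mono {s : Fin r → (x : M) → V x} {hs : IsLocalFrameOn 𝓘(ℝ, E) F ∞ s u}
    (h : HasSkewCurvature cov hs) (hu : IsOpen u) (hu' : IsOpen u') (hsub : u' ⊆ u) :
    HasSkewCurvature cov (hs.mono hsub) := by
  intro x hx
  have h1 : (Matrix.of fun i j => hs.coeff i x (s j x)) = 1 := by
    ext i j
    rw [Matrix.of_apply, hs.coeff_apply_of_mem (hsub hx) (s j), ← hs.toBasisAt_coe (hsub hx) j,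
      Basis.repr_self, Finsupp.single_apply, Matrix.one_apply]
    simp only [eq_comm]
  have h2 : curvatureMatrix cov (hs.mono hsub) x = curvatureMatrix cov hs x := by
    ext i j v
    have h3 := sum_coeff_mul_curvatureMatrix cov hs (hs.mono hsub) hu hu' (hsub hx) hx (v 0) (v 1)
    rw [h1, Matrix.one_mul, Matrix.mul_one] at h3
    have h4 : v = ![v 0, v 1] := by
      funext b
      fin_cases b <;> rfl
    rw [h4]
    exact congrFun (congrFun h3 i) j
  rw [h2]
  exact h x (hsub hx)

/-- A frame with skew-symmetric curvature that is positively oriented at `p` restricts to a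
positively oriented one near `p`. -/
theorem exists_positive_skew_frame_of_det_pos (o : BundleOrientation E F V r) {p : M}
    {s t : Fin r → (x : M) → V x} (hs : IsLocalFrameOn 𝓘(ℝ, E) F ∞ s u)
    (ht : IsLocalFrameOn 𝓘(ℝ, E) F ∞ t u') (hu : IsOpen u) (hu' : IsOpen u') (hp : p ∈ u)
    (hp' : p ∈ u') (hskew : HasSkewCurvature cov hs) (hpos : IsPositiveFrame o ht)
    (hdet : 0 < (Matrix.of fun i j => ht.coeff i p (s j p)).det) :
    ∃ w : Set M, IsOpen w ∧ p ∈ w ∧ ∃ (s : Fin r → (x : M) → V x)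
      (hs : IsLocalFrameOn 𝓘(ℝ, E) F ∞ s w), IsPositiveFrame o hs ∧ HasSkewCurvature cov hs := by
  have h1 : ∀ᶠ x in 𝓝 p, 0 < (Matrix.of fun i j => ht.coeff i x (s j x)).det :=
    (continuousAt_det_coeff ht hs hu' hu hp' hp).eventually_const_lt hdet
  obtain ⟨w, hw, hwo, hpw⟩ := eventually_nhds_iff.1
    (h1.and ((hu.eventually_mem hp).and (hu'.eventually_mem hp')))
  have hsub : w ⊆ u := fun x hx => (hw x hx).2.1
  refine ⟨w, hwo, hpw, s, hs.mono hsub, fun x hx => ?_, hskew.mono cov hu hwo hsub⟩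
  rw [← hpos x (hw x hx).2.2]
  exact ((orientation_eq_iff_det_coeff_pos ht (hs.mono hsub) (hw x hx).2.2 hx).2 (hw x hx).1).symm

/-- If a frame with skew-symmetric curvature has the wrong orientation, exchanging two of its
vectors corrects this; in rank zero the orientation is never wrong. -/
theorem exists_positive_skew_frame (o : BundleOrientation E F V (2 * m))
    (hcov : IsQuasiMetric (2 * m) cov) (p : M) :
    ∃ w : Set M, IsOpen w ∧ p ∈ w ∧ ∃ (s : Fin (2 * m) → (x : M) → V x)
      (hs : IsLocalFrameOn 𝓘(ℝ, E) F ∞ s w), IsPositiveFrame o hs ∧ HasSkewCurvature cov hs := by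
  obtain ⟨u, hu, hp, s, hs, hskew⟩ := hcov p
  obtain ⟨u', hu', hp', t, ht, hpos⟩ := o.exists_frame p
  have hne : (Matrix.of fun i j => ht.coeff i p (s j p)).det ≠ 0 := by
    rw [det_coeff_eq_basis_det ht hp',
      show (fun j => s j p) = hs.toBasisAt hp from (funext (hs.toBasisAt_coe hp)).symm]
    exact ((ht.toBasisAt hp').isUnit_det (hs.toBasisAt hp)).ne_zero
  rcases lt_or_gt_of_ne hne with hneg | hdet
  · have hm : 0 < m := by
      rcases Nat.eq_zero_or_pos m with rfl | hm
      · have : IsEmpty (Fin (2 * 0)) := inferInstanceAs (IsEmpty (Fin 0))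
        rw [Matrix.det_isEmpty] at hneg
        exact absurd hneg (by norm_num)
      · exact hm
    let κ : Equiv.Perm (Fin (2 * m)) :=
      Equiv.swap (pairIndex m ⟨⟨0, hm⟩, 0⟩) (pairIndex m ⟨⟨0, hm⟩, 1⟩)
    have hκ : Equiv.Perm.sign κ = -1 := Equiv.Perm.sign_swap (by simp)
    have hs' : IsLocalFrameOn 𝓘(ℝ, E) F ∞ (fun i => s (κ i)) u :=
      { linearIndependent := fun hx => (hs.linearIndependent hx).comp _ κ.injective
        generating := fun {x} hx => by
          have h := hs.generating hx
          rwa [← κ.surjective.range_comp (fun i => s i x)] at h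
        contMDiffOn := fun i => hs.contMDiffOn _ }
    have hskew' : HasSkewCurvature cov hs' := by
      intro x hx
      ext i j : 1
      rw [Matrix.transpose_apply, Matrix.neg_apply, curvatureMatrix_comp_perm cov hs κ hs',
        curvatureMatrix_comp_perm cov hs κ hs']
      exact congrFun (congrFun (hskew x hx) (κ i)) (κ j)
    refine exists_positive_skew_frame_of_det_pos cov o hs' ht hu hu' hp hp' hskew' hpos ?_
    have h1 : (Matrix.of fun i j => ht.coeff i p (s (κ j) p)) =
        (Matrix.of fun i j => ht.coeff i p (s j p)).submatrix id κ := rfl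
    rw [h1, Matrix.det_permute', hκ]
    simpa using hneg
  · exact exists_positive_skew_frame_of_det_pos cov o hs ht hu hu' hp hp' hskew hpos hdet

/-- The Pfaffians of two positively oriented frames with skew-symmetric curvature agree, since the
curvature matrices are conjugate by a matrix of positive determinant. -/
theorem pfaffian_curvatureMatrix_eq (o : BundleOrientation E F V (2 * m))
    {s s' : Fin (2 * m) → (x : M) → V x} (hs : IsLocalFrameOn 𝓘(ℝ, E) F ∞ s u)
    (hs' : IsLocalFrameOn 𝓘(ℝ, E) F ∞ s' u') (hu : IsOpen u) (hu' : IsOpen u')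
    (hpos : IsPositiveFrame o hs) (hpos' : IsPositiveFrame o hs')
    (hskew : HasSkewCurvature cov hs) (hskew' : HasSkewCurvature cov hs') {x : M} (hx : x ∈ u)
    (hx' : x ∈ u') :
    pfaffian (curvatureMatrix cov hs x) = pfaffian (curvatureMatrix cov hs' x) := by
  ext v
  rw [pfaffian_apply, pfaffian_apply]
  congr 3
  funext w
  symm
  refine polarPfaffian_eq_of_conj (fun i => ?_) (fun i => ?_)
    ((orientation_eq_iff_det_coeff_pos hs hs' hx hx').1 ((hpos x hx).trans (hpos' x hx').symm))
    (fun i => sum_coeff_mul_curvatureMatrix cov hs hs' hu hu' hx hx' _ _)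
  · ext a b
    exact congrArg (fun f => f ![w (pairIndex m ⟨i, 0⟩), w (pairIndex m ⟨i, 1⟩)])
      (congrFun (congrFun (hskew x hx) a) b)
  · ext a b
    exact congrArg (fun f => f ![w (pairIndex m ⟨i, 0⟩), w (pairIndex m ⟨i, 1⟩)])
      (congrFun (congrFun (hskew' x hx') a) b)

variable {cov}

/-- The coordinate expression of an Euler form, near a point of the domain of a frame. -/
theorem IsEulerForm.eventually_inChart_eq {o : BundleOrientation E F V (2 * m)}
    {η : FormField E M (2 * m)}
    (hη : IsEulerForm o cov η) {s : Fin (2 * m) → (x : M) → V x}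
    {hs : IsLocalFrameOn 𝓘(ℝ, E) F ∞ s u} (hu : IsOpen u) (hpos : IsPositiveFrame o hs)
    (hskew : HasSkewCurvature cov hs) {φ : OpenPartialHomeomorph M E} (hφ : φ ∈ atlas E M) {y : E}
    (hy : y ∈ φ.target) (hyu : φ.symm y ∈ u) :
    ∀ᶠ z in 𝓝 y, ∀ v, inChart φ η z v =
      ((2 : ℝ) ^ m * (m.factorial : ℝ))⁻¹ * ((2 : ℝ) ^ m)⁻¹ * antisym (fun w => polarPfaffian
        fun i => localCurvature (connectionInChart cov hs φ) z
          (w (pairIndex m ⟨i, 0⟩)) (w (pairIndex m ⟨i, 1⟩))) v := by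
  filter_upwards [φ.open_target.mem_nhds hy,
    (φ.continuousAt_symm hy).eventually_mem (hu.mem_nhds hyu)] with z hz hzu v
  have h1 := pfaffian_apply (curvatureMatrix cov hs (φ.symm z)) (fun i => chartDeriv φ z (v i))
  rw [← hη u s hs hu hpos hskew _ hzu] at h1
  refine h1.trans ?_
  rw [mul_assoc]
  refine congrArg _ (congrArg _ (Finset.sum_congr rfl fun τ _ => ?_))
  refine congrArg _ (congrArg polarPfaffian ?_)
  funext i
  ext a b
  exact curvatureMatrix_chartDeriv cov hs hu hφ hz hzu a b _ _

theorem IsEulerForm.isSmoothForm {o : BundleOrientation E F V (2 * m)}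
    (hcov : IsQuasiMetric (2 * m) cov) {η : FormField E M (2 * m)} (hη : IsEulerForm o cov η) :
    IsSmoothForm η := by
  intro φ hφ y hy
  obtain ⟨u, hu, hyu, s, hs, hpos, hskew⟩ := exists_positive_skew_frame cov o hcov (φ.symm y)
  refine (contDiffAt_alternating_of_apply fun v => ?_).contDiffWithinAt
  refine ContDiffAt.congr_of_eventuallyEq ?_
    ((hη.eventually_inChart_eq hu hpos hskew hφ hy hyu).mono fun z hz => hz v)
  refine contDiffAt_const.mul (ContDiffAt.sum fun τ _ => contDiffAt_const.mul
    (ContDiffAt.sum fun σ _ => contDiffAt_const.mul (contDiffAt_prod fun i _ => ?_)))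
  exact contDiffAt_localCurvature
    (fun i j => contDiffAt_connectionInChart cov hs hu hφ hy hyu i j) _ _ _ _

theorem IsEulerForm.extD_eq_zero {o : BundleOrientation E F V (2 * m)}
    (hcov : IsQuasiMetric (2 * m) cov) {η : FormField E M (2 * m)} (hη : IsEulerForm o cov η) :
    extD η = 0 := by
  funext x
  obtain ⟨u, hu, hxu, s, hs, hpos, hskew⟩ := exists_positive_skew_frame cov o hcov x
  have hφ := chart_mem_atlas E x
  have hy := mem_chart_target E x
  have hyx : (chartAt E x).symm (chartAt E x x) = x :=
    (chartAt E x).left_inv (mem_chart_source E x)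
  have hyu : (chartAt E x).symm (chartAt E x x) ∈ u := by rwa [hyx]
  have h1 : extDeriv (inChart (chartAt E x) η) (chartAt E x x) = 0 := by
    refine extDeriv_eq_zero_of_eventually_eq_polarPfaffian
      (fun i j => contDiffAt_connectionInChart cov hs hu hφ hy hyu i j) (fun v w => ?_)
      ((hη.isSmoothForm hcov).differentiableAt x) _
      (hη.eventually_inChart_eq hu hpos hskew hφ hy hyu)
    ext i j
    rw [Matrix.transpose_apply, Matrix.neg_apply,
      ← curvatureMatrix_chartDeriv cov hs hu hφ hy hyu,
      ← curvatureMatrix_chartDeriv cov hs hu hφ hy hyu]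
    exact congrArg (fun f => f ![chartDeriv _ _ v, chartDeriv _ _ w])
      (congrFun (congrFun (hskew _ hyu) i) j)
  rw [extD, h1]
  rfl

variable (cov) in
/-- The Euler form is obtained by evaluating at each point the Pfaffian of a positively oriented
frame with skew-symmetric curvature. -/
theorem existsUnique_isEulerForm (o : BundleOrientation E F V (2 * m))
    (hcov : IsQuasiMetric (2 * m) cov) :
    ∃! η : FormField E M (2 * m), IsEulerForm o cov η := by
  choose w hw hp s hs hpos hskew using exists_positive_skew_frame cov o hcov
  refine ⟨fun x => pfaffian (curvatureMatrix cov (hs x) x), ?_, fun η hη => ?_⟩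
  · intro u t ht hu htpos htskew x hx
    exact pfaffian_curvatureMatrix_eq cov o (hs x) ht (hw x) hu (hpos x) htpos (hskew x) htskew
      (hp x) hx
  · funext x
    exact hη (w x) (s x) (hs x) (hw x) (hpos x) (hskew x) x (hp x)

end Restriction

end EulerForm

end QuasiMetric

end

theorem mainTheorem3
    {E : Type*} [NormedAddCommGroup E] [NormedSpace ℝ E] [FiniteDimensional ℝ E]
    {M : Type*} [TopologicalSpace M] [ChartedSpace E M] [IsManifold 𝓘(ℝ, E) ∞ M]
    [T2Space M] [SecondCountableTopology M]
    {m : ℕ}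
    {F : Type*} [NormedAddCommGroup F] [NormedSpace ℝ F] [FiniteDimensional ℝ F]
    (hF : finrank ℝ F = 2 * m)
    {V : M → Type*} [TopologicalSpace (TotalSpace F V)]
    [∀ x, AddCommGroup (V x)] [∀ x, Module ℝ (V x)] [∀ x, TopologicalSpace (V x)]
    [∀ x, IsTopologicalAddGroup (V x)] [∀ x, ContinuousSMul ℝ (V x)]
    [FiberBundle F V] [VectorBundle ℝ F V] [ContMDiffVectorBundle ∞ F V 𝓘(ℝ, E)]
    (o : QuasiMetric.BundleOrientation E F V (2 * m))
    (cov : CovariantDerivative 𝓘(ℝ, E) F V)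
    [CovariantDerivative.ContMDiffCovariantDerivative cov ∞]
    (hcov : QuasiMetric.IsQuasiMetric (2 * m) cov) :
    -- the local Pfaffian forms agree on overlaps
    (∀ (u u' : Set M) (s s' : Fin (2 * m) → (x : M) → V x)
        (hs : IsLocalFrameOn 𝓘(ℝ, E) F ∞ s u) (hs' : IsLocalFrameOn 𝓘(ℝ, E) F ∞ s' u'),
        IsOpen u → IsOpen u' →
        QuasiMetric.IsPositiveFrame o hs → QuasiMetric.IsPositiveFrame o hs' →
        QuasiMetric.HasSkewCurvature cov hs → QuasiMetric.HasSkewCurvature cov hs' →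
        ∀ x ∈ u ∩ u', QuasiMetric.pfaffian (QuasiMetric.curvatureMatrix cov hs x) =
          QuasiMetric.pfaffian (QuasiMetric.curvatureMatrix cov hs' x)) ∧
    -- they glue to a unique global form
    (∃! η : QuasiMetric.FormField E M (2 * m), QuasiMetric.IsEulerForm o cov η) ∧
    -- the global form is smooth and closed
    (∀ η : QuasiMetric.FormField E M (2 * m), QuasiMetric.IsEulerForm o cov η →
      QuasiMetric.IsSmoothForm η ∧ QuasiMetric.extD η = 0) ∧
    -- it defines a class in de Rham cohomology
    (∃! c : QuasiMetric.DeRham E M (2 * m), ∃ η : QuasiMetric.closedForms E M (2 * m),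
      QuasiMetric.IsEulerForm o cov η.1 ∧ QuasiMetric.deRhamClass η = c) := by
  refine ⟨?_, QuasiMetric.existsUnique_isEulerForm cov o hcov, fun η hη =>
    ⟨hη.isSmoothForm hcov, hη.extD_eq_zero hcov⟩, ?_⟩
  · intro u u' s s' hs hs' hu hu' hpos hpos' hskew hskew' x hx
    exact QuasiMetric.pfaffian_curvatureMatrix_eq cov o hs hs' hu hu' hpos hpos' hskew hskew'
      hx.1 hx.2
  · obtain ⟨η, hη, huniq⟩ := QuasiMetric.existsUnique_isEulerForm cov o hcov
    refine ⟨QuasiMetric.deRhamClass ⟨η, QuasiMetric.mem_closedForms.2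
      ⟨hη.isSmoothForm hcov, hη.extD_eq_zero hcov⟩⟩, ⟨_, hη, rfl⟩, ?_⟩
    rintro _ ⟨η', hη', rfl⟩
    congr 1
    exact Subtype.ext (huniq _ hη')
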